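/- **Model.** Let $\mu$ be a probability law on $\mathbb R$ symmetric about $0$, let $\theta_1>1/\mathbb E[\operatorname{sech}^2(h)]$ for $h\sim\mu$ (low temperature). For $S\subset[n]$ with $|S|=k$, one sample $\sigma\in\{-1,1\}^n$ under the alternative $\mathbb P_S$ is drawn as follows: $h_1,\dots,h_n$ are i.i.d. with law $\mu$ and, given $h$, $\sigma$ has probability proportional to $\exp\big(\frac{\theta_1}{2k}(\sum_{i\in S}\sigma_i)^2+\sum_{i=1}^n h_i\sigma_i\big)$. Under the null $\mathbb P_0$ the quadratic term is absent. We observe $m$ i.i.d. samples $\sigma^{(1)},\dots,\sigma^{(m)}$ (each with its own field). Put $m_S=\frac1k\sum_{i\in S}\sigma_i$, $m_{S^c}=\frac1{n-k}\sum_{i\notin S}\sigma_i$ (with $\frac{n-k}{k}m_{S^c}$ read as $0$ if $k=n$), $$\phi_3=\max_{|S'|=k}\frac1m\sum_{j=1}^m\Big|\frac1k\sum_{i\in S'}\sigma^{(j)}_i\Big|,\qquad T=\Big|\frac1k\sum_{i=1}^n\sigma_i\Big|=\Big|m_S+\frac{n-k}{k}m_{S^c}\Big|,\qquad \phi_4=\frac1m\sum_{j=1}^m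 T(\sigma^{(j)}).$$ The test based on $\phi$ with threshold $\tau$ rejects the null iff $\phi\ge\tau$; its error at $S$ is $\mathbb P_0(\phi\ge\tau)+\mathbb P_S(\phi<\tau)$. Let $F(x,v)=\sqrt{\tfrac{2v}{\pi}}\,e^{-x^2/(2v)}+x\big(1-2\Phi(-x/\sqrt v)\big)$ be the mean of the folded normal law $\mathcal{FN}(x,v)$ of $|N(x,v)|$, where $\Phi$ is the standard normal distribution function. **Theorem.** The equation $y=\mathbb E[\tanh(\theta_1y+h)]$ has a smallest positive solution $x$, and the following hold. 1. *(Scan test, $m\asymp\log n$.)* For every $\tau\in(0,x)$ there is $C>0$ such that for every $\delta>0$ there is $K$ such that, whenever $k\ge K$ and $m\ge C\log n$, the test based on $\phi_3$ with threshold $\tau$ has error at most $\delta$ at every $S\subset[n]$ with $|S|=k$. 2. *(Global test, $k\asymp\sqrt n$, $m\asymp1$.)* For all $0<a\le b$, $t\in(0,1)$ and $\delta>0$ there are $M,N$ such that, whenever $n\ge N$, $a\sqrt n\le k\le b\sqrt n$ and $m\ge M$, the test based on $\phi_4$ with threshold $(1-t)F(0,\frac n{k^2})+tF(x,\frac n{k^2})$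 has error at most $\delta$ at every $S$ with $|S|=k$. 3. *(Folded normal limits, $k\asymp\sqrt n$.)* Along every sequence with $n\to\infty$ and $n/k^2\to v\in(0,\infty)$: under the null, $T\to\mathcal{FN}(0,v)$ in distribution and $\mathbb E_0[T]\to F(0,v)=\sqrt{2v/\pi}$; and, if $x$ is the only positive solution, then under $\mathbb P_S$ with any $S=S_n$, $|S_n|=k$, $T\to\mathcal{FN}(x,v)$ in distribution and $\mathbb E_S[T]\to F(x,v)$. 4. *(Global test, $k=\omega(\sqrt n)$, one sample.)* For every $\tau\in(0,x)$ and $\delta>0$ there is $A$ such that, whenever $k\ge 1$, $k\ge A\sqrt n$ and $m\ge1$ (in particular for $m=1$), the test based on $\phi_4$ with threshold $\tau$ has error at most $\delta$ at every $S\subset[n]$ with $|S|=k$. Moreover, when $k/\sqrt n\to\infty$, $T\to0$ in probability under the null, and, if $x$ is the only positive solution, $T\to x$ in probability under $\mathbb P_S$, uniformly over $S$ with $|S|=k$: for all $\varepsilon,\delta>0$ there is $A$ such that $k\ge1$, $k\ge A\sqrt n$ imply $\mathbb P_0(T\ge\varepsilon)\le\delta$, respectively $\mathbb P_S(|T-x|\ge\varepsilon)\le\delta$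 for all $S$ with $|S|=k$. -/

import Mathlib

open MeasureTheory ProbabilityTheory Filter
open scoped NNReal Topology

namespace PlantedRFCW

noncomputable section

/-- Spin configurations on `n` sites (`true` stands for `+1`, `false` for `-1`). -/
abbrev Config (n : ℕ) : Type := Fin n → Bool

/-- The value `±1` of a spin. -/
def spin (b : Bool) : ℝ := if b then 1 else -1

/-- Quenched Gibbs probability of `σ` given the field `h`, for the Hamiltonian
`J σ + ∑ i, h i * σ i`. -/
def gibbsProb {n : ℕ} (J : Config n → ℝ) (h : Fin n → ℝ) (σ : Config n) : ℝ :=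
  Real.exp (J σ + ∑ i, h i * spin (σ i)) / ∑ τ : Config n, Real.exp (J τ + ∑ i, h i * spin (τ i))

/-- Probability of `σ` when the field has i.i.d. coordinates of law `μ` and `σ` is drawn from the
Gibbs measure given the field. -/
def siteProb {n : ℕ} (μ : Measure ℝ) (J : Config n → ℝ) (σ : Config n) : ℝ :=
  ∫ h, gibbsProb J h σ ∂(Measure.pi fun _ : Fin n => μ)

/-- The law of one sample `σ`, as a measure on configurations. -/
def fieldLaw {n : ℕ} (μ : Measure ℝ) (J : Config n → ℝ) : Measure (Config n) :=
  ∑ σ : Config n, ENNReal.ofReal (siteProb μ J σ) • Measure.dirac σ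

/-- Curie-Weiss interaction on the clique `S`: `θ / (2 |S|) * (∑ i ∈ S, σ i) ^ 2`. -/
def cliqueInteraction {n : ℕ} (θ : ℝ) (S : Finset (Fin n)) (σ : Config n) : ℝ :=
  θ / (2 * (S.card : ℝ)) * (∑ i ∈ S, spin (σ i)) ^ 2

/-- Law of one sample under the null hypothesis: no interaction. -/
def nullLaw (n : ℕ) (μ : Measure ℝ) : Measure (Config n) := fieldLaw μ (fun _ => 0)

/-- Law of one sample under the alternative with hidden clique `S`. -/
def cliqueLaw {n : ℕ} (μ : Measure ℝ) (θ : ℝ) (S : Finset (Fin n)) : Measure (Config n) :=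
  fieldLaw μ (cliqueInteraction θ S)

/-- Law of `m` i.i.d. samples under the null (each sample has its own independent field). -/
def nullSampleLaw (n m : ℕ) (μ : Measure ℝ) : Measure (Fin m → Config n) :=
  Measure.pi fun _ => nullLaw n μ

/-- Law of `m` i.i.d. samples under the alternative with hidden clique `S`
(each sample has its own independent field). -/
def cliqueSampleLaw {n : ℕ} (m : ℕ) (μ : Measure ℝ) (θ : ℝ) (S : Finset (Fin n)) :
    Measure (Fin m → Config n) :=
  Measure.pi fun _ => cliqueLaw μ θ S

/-- Average magnetization `m_S` of `σ` on `S`. -/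
def magnetization {n : ℕ} (S : Finset (Fin n)) (σ : Config n) : ℝ :=
  (∑ i ∈ S, spin (σ i)) / (S.card : ℝ)

/-- `φ_S = (1/m) ∑ j, |(1/k) ∑ i ∈ S, σ i^(j)|`, where `k = |S|`. -/
def localStat {n m : ℕ} (S : Finset (Fin n)) (X : Fin m → Config n) : ℝ :=
  (∑ j, |magnetization S (X j)|) / (m : ℝ)

/-- The scan statistic: the maximum of `φ_S` over all `S` of size `k`. -/
def scanStat {n m : ℕ} (k : ℕ) (X : Fin m → Config n) : ℝ :=
  ⨆ S : {S : Finset (Fin n) // S.card = k}, localStat S.1 X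

/-- The one-sample global statistic `|(1/k) ∑ i, σ i|`. It does not involve the clique; it equals
`|m_S + ((n - k) / k) * m_{Sᶜ}|` for every `S` of size `k ≥ 1`
(see `globalTerm_eq`). -/
def globalTerm {n : ℕ} (k : ℕ) (σ : Config n) : ℝ := |(∑ i, spin (σ i)) / (k : ℝ)|

/-- The global statistic: the average of the one-sample statistic over the `m` samples. -/
def globalStat {n m : ℕ} (k : ℕ) (X : Fin m → Config n) : ℝ :=
  (∑ j, globalTerm k (X j)) / (m : ℝ)

/-- Sum of the Type I error and the Type II error, when the hidden clique is `S`, of the test that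
rejects the null hypothesis if and only if `T ≥ τ`. -/
def totalError {n m : ℕ} (μ : Measure ℝ) (θ : ℝ) (T : (Fin m → Config n) → ℝ) (τ : ℝ)
    (S : Finset (Fin n)) : ℝ :=
  (nullSampleLaw n m μ).real {X | τ ≤ T X} + (cliqueSampleLaw m μ θ S).real {X | T X < τ}

/-- `E[sech² h]`. -/
def meanSechSq (μ : Measure ℝ) : ℝ := ∫ h, (1 / Real.cosh h) ^ 2 ∂μ

/-- The positive solutions `y` of `y = E[tanh (θ y + h)]`. -/
def positiveSolutions (μ : Measure ℝ) (θ : ℝ) : Set ℝ :=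
  {y | 0 < y ∧ y = ∫ h, Real.tanh (θ * y + h) ∂μ}

/-- The closed form of the mean of the folded normal law `|N(x, v)|`, for `v > 0`. -/
def foldedMean (x v : ℝ) : ℝ :=
  √v * √(2 / Real.pi) * Real.exp (-(x ^ 2) / (2 * v))
    + x * (1 - 2 * cdf (gaussianReal 0 1) (-x / √v))

theorem globalTerm_eq {n : ℕ} (S : Finset (Fin n)) (hS : 0 < S.card) (σ : Config n) :
    globalTerm S.card σ = |magnetization S σ
      + ((n : ℝ) - S.card) / S.card * magnetization Sᶜ σ| := by
  have hk : (S.card : ℝ) ≠ 0 := by positivity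
  have hc : ((Sᶜ.card : ℕ) : ℝ) = (n : ℝ) - S.card := by
    rw [Finset.card_compl, Fintype.card_fin, Nat.cast_sub]
    simpa using S.card_le_univ
  unfold globalTerm magnetization
  rw [← Finset.sum_add_sum_compl S, ← hc]
  by_cases h0 : ((Sᶜ.card : ℕ) : ℝ) = 0
  · have : Sᶜ = ∅ := by
      rw [← Finset.card_eq_zero]; exact_mod_cast h0
    simp [this]
  · congr 1
    field_simp

theorem gibbsProb_nonneg {n : ℕ} (J : Config n → ℝ) (h : Fin n → ℝ) (σ : Config n) :
    0 ≤ gibbsProb J h σ := by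
  unfold gibbsProb; positivity

theorem sum_gibbsProb {n : ℕ} (J : Config n → ℝ) (h : Fin n → ℝ) :
    ∑ σ, gibbsProb J h σ = 1 := by
  unfold gibbsProb
  rw [← Finset.sum_div]
  apply div_self
  have : 0 < ∑ τ : Config n, Real.exp (J τ + ∑ i, h i * spin (τ i)) :=
    Finset.sum_pos (fun _ _ => Real.exp_pos _) Finset.univ_nonempty
  exact this.ne'

theorem integrable_gibbsProb {n : ℕ} (μ : Measure ℝ) [IsProbabilityMeasure μ] (J : Config n → ℝ)
    (σ : Config n) :
    Integrable (fun h => gibbsProb J h σ) (Measure.pi fun _ : Fin n => μ) := by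
  refine Integrable.of_bound (C := 1) ?_ ?_
  · apply Measurable.aestronglyMeasurable
    unfold gibbsProb
    fun_prop
  · refine Eventually.of_forall fun h => ?_
    rw [Real.norm_of_nonneg (gibbsProb_nonneg J h σ), ← sum_gibbsProb J h]
    exact Finset.single_le_sum (fun τ _ => gibbsProb_nonneg J h τ) (Finset.mem_univ σ)

theorem sum_siteProb {n : ℕ} (μ : Measure ℝ) [IsProbabilityMeasure μ] (J : Config n → ℝ) :
    ∑ σ, siteProb μ J σ = 1 := by
  unfold siteProb
  rw [← integral_finsetSum _ (fun σ _ => integrable_gibbsProb μ J σ)]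
  simp [sum_gibbsProb]

instance fieldLaw.instIsProbabilityMeasure {n : ℕ} (μ : Measure ℝ) [IsProbabilityMeasure μ]
    (J : Config n → ℝ) : IsProbabilityMeasure (fieldLaw μ J) := by
  constructor
  have h0 : ∀ σ ∈ (Finset.univ : Finset (Config n)), 0 ≤ siteProb μ J σ := fun σ _ =>
    integral_nonneg fun h => gibbsProb_nonneg J h σ
  unfold fieldLaw
  simp only [Measure.coe_finsetSum, Finset.sum_apply, Measure.smul_apply, measure_univ,
    smul_eq_mul, mul_one]
  rw [← ENNReal.ofReal_sum_of_nonneg h0, sum_siteProb, ENNReal.ofReal_one]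

instance nullLaw.instIsProbabilityMeasure (n : ℕ) (μ : Measure ℝ) [IsProbabilityMeasure μ] :
    IsProbabilityMeasure (nullLaw n μ) := by
  unfold nullLaw; infer_instance

instance cliqueLaw.instIsProbabilityMeasure {n : ℕ} (μ : Measure ℝ) [IsProbabilityMeasure μ]
    (θ : ℝ) (S : Finset (Fin n)) : IsProbabilityMeasure (cliqueLaw μ θ S) := by
  unfold cliqueLaw; infer_instance

end

end PlantedRFCW

open PlantedRFCW

/-!
Since `μ` is symmetric, spins may be flipped at will: under the null they are independent and
uniform, and under `cliqueLaw` the spins outside the clique `S` may be replaced by fresh uniform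
ones. So the global statistic is `|m_S + W|`, where `W`, given `m_S`, is a normalized sum of uniform
spins, close to a centred Gaussian variable of standard deviation `√n / k`.

The law of `m_S` is found by linearization. The interaction is convex in `m_S`, hence lies above its
tangents; since a linear interaction only shifts the field, the partition function is bounded below
by an explicit product, and the event `m_S = y` has quenched probability at most
`exp (∑ i ∈ S, (g x (h i) - g y (h i)))`, with `g` the `siteFreeEnergy`. Averaging a small power of
this over the field gives exponential decay as soon as `freeEnergy y > freeEnergy x`. The derivative
of the free energy is `θ (y - E[tanh (θ y + h)])`, so it decreases on `[0, x]`, and increases beyond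
`x` if `x` is the only positive solution: `|m_S|` exceeds every `τ < x`, respectively concentrates
at `x`.

The scan statistic under the null is controlled by a Chernoff bound and a union bound. For
`k ≍ √n`, the separation comes from `E|y + s Z| = E[max |y| |s Z|]`, which is monotone in `|y|`.
-/

namespace PlantedRFCW

/-! ### Uniform spins and gauge symmetry -/

section Spin

theorem abs_spin (b : Bool) : |spin b| = 1 := by cases b <;> simp [spin]

theorem spin_mul_self (b : Bool) : spin b * spin b = 1 := by cases b <;> simp [spin]

theorem spin_beq (a b : Bool) : spin (a == b) = spin a * spin b := by
  cases a <;> cases b <;> simp [spin]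

theorem abs_magnetization_le_one {n : ℕ} (S : Finset (Fin n)) (σ : Config n) :
    |magnetization S σ| ≤ 1 := by
  unfold magnetization
  rw [abs_div, Nat.abs_cast]
  refine div_le_one_of_le₀ ((Finset.abs_sum_le_sum_abs _ _).trans ?_) (by positivity)
  simp [abs_spin]

end Spin

/-- The law of a fair coin. -/
noncomputable def fairCoin : Measure Bool := (PMF.uniformOfFintype Bool).toMeasure

instance fairCoin.instIsProbabilityMeasure : IsProbabilityMeasure fairCoin :=
  inferInstanceAs (IsProbabilityMeasure (PMF.uniformOfFintype Bool).toMeasure)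

/-- The law of `n` independent uniform spins; it is the null law whenever the field is symmetric,
see `nullLaw_eq_uniformSpins`. -/
noncomputable def uniformSpins (n : ℕ) : Measure (Config n) := Measure.pi fun _ => fairCoin

instance uniformSpins.instIsProbabilityMeasure (n : ℕ) : IsProbabilityMeasure (uniformSpins n) :=
  inferInstanceAs (IsProbabilityMeasure (Measure.pi fun _ => fairCoin))

section FairCoin

theorem fairCoin_singleton (b : Bool) : fairCoin {b} = 2⁻¹ := by
  simp [fairCoin]

theorem integral_fairCoin {E : Type*} [NormedAddCommGroup E] [NormedSpace ℝ E] [CompleteSpace E]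
    (f : Bool → E) : ∫ b, f b ∂fairCoin = (1 / 2 : ℝ) • (f true + f false) := by
  simp [fairCoin, PMF.integral_eq_sum]

theorem measurePreserving_beq_fairCoin (a : Bool) :
    MeasurePreserving (a == ·) fairCoin fairCoin := by
  refine ⟨.of_discrete, Measure.ext_of_singleton fun b => ?_⟩
  have hpre : (a == ·) ⁻¹' {b} = {a == b} := by
    ext c; cases a <;> cases b <;> cases c <;> simp
  rw [Measure.map_apply .of_discrete (measurableSet_singleton b), hpre, fairCoin_singleton,
    fairCoin_singleton]

end FairCoin

section Twist

variable {n : ℕ}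

/-- The gauge transformation of the configuration `σ` by `ε`: coordinatewise product of the
spins. -/
def twist (ε σ : Config n) : Config n := fun i => ε i == σ i

theorem spin_twist (ε σ : Config n) (i : Fin n) :
    spin (twist ε σ i) = spin (ε i) * spin (σ i) := spin_beq _ _

theorem twist_twist (ε σ : Config n) : twist ε (twist ε σ) = σ := by
  funext i; simp only [twist]; cases ε i <;> cases σ i <;> rfl

theorem twist_comm (ε σ : Config n) : twist ε σ = twist σ ε := by
  funext i; simp only [twist]; cases ε i <;> cases σ i <;> rfl

theorem preimage_twist_singleton (ε σ : Config n) : twist ε ⁻¹' {σ} = {twist ε σ} := by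
  ext τ
  simp only [Set.mem_preimage, Set.mem_singleton_iff]
  exact ⟨fun h => by rw [← h, twist_twist], fun h => by rw [h, twist_twist]⟩

theorem sum_comp_twist {M : Type*} [AddCommMonoid M] (ε : Config n) (f : Config n → M) :
    ∑ σ, f (twist ε σ) = ∑ σ, f σ :=
  Fintype.sum_equiv (Function.Involutive.toPerm (twist ε) (twist_twist ε)) _ _ fun _ => rfl

theorem measurePreserving_twist_uniformSpins (ε : Config n) :
    MeasurePreserving (twist ε) (uniformSpins n) (uniformSpins n) :=
  measurePreserving_pi (f := fun i => (ε i == ·)) _ _ fun i => measurePreserving_beq_fairCoin (ε i)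

theorem gibbsProb_twist {J : Config n → ℝ} {ε : Config n} (hJ : ∀ σ, J (twist ε σ) = J σ)
    (h : Fin n → ℝ) (σ : Config n) :
    gibbsProb J (fun i => spin (ε i) * h i) (twist ε σ) = gibbsProb J h σ := by
  have hamiltonian_twist : ∀ τ : Config n,
      J (twist ε τ) + ∑ i, spin (ε i) * h i * spin (twist ε τ i)
        = J τ + ∑ i, h i * spin (τ i) := fun τ => by
    rw [hJ]
    congr 1
    refine Finset.sum_congr rfl fun i _ => ?_
    rw [spin_twist]
    linear_combination (h i * spin (τ i)) * spin_mul_self (ε i)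
  unfold gibbsProb
  rw [← sum_comp_twist ε]
  simp_rw [hamiltonian_twist]

theorem cliqueInteraction_twist (θ : ℝ) (S : Finset (Fin n)) {ε : Config n}
    (hε : ∀ i ∈ S, ε i = true) (σ : Config n) :
    cliqueInteraction θ S (twist ε σ) = cliqueInteraction θ S σ := by
  unfold cliqueInteraction
  congr 2
  exact Finset.sum_congr rfl fun i hi => by simp [twist, hε i hi]

end Twist

theorem integral_comp_of_measurePreserving {α β E : Type*} [MeasurableSpace α] [MeasurableSpace β]
    [DiscreteMeasurableSpace β] [Countable β] [NormedAddCommGroup E] [NormedSpace ℝ E]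
    {ν : Measure α} {ρ : Measure β} {g : α → β} (hg : MeasurePreserving g ν ρ) (f : β → E) :
    ∫ a, f (g a) ∂ν = ∫ b, f b ∂ρ := by
  rw [← hg.map_eq]
  exact (integral_map hg.measurable.aemeasurable .of_discrete).symm

section FieldLaw

variable {n : ℕ} {μ : Measure ℝ}

theorem measurable_gibbsProb (J : Config n → ℝ) (σ : Config n) :
    Measurable fun h => gibbsProb J h σ := by
  unfold gibbsProb; fun_prop

theorem fieldLaw_singleton (J : Config n → ℝ) (σ : Config n) :
    fieldLaw μ J {σ} = ENNReal.ofReal (siteProb μ J σ) := by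
  simp [fieldLaw, Finset.sum_apply, Set.indicator_apply]

variable [IsProbabilityMeasure μ]

theorem siteProb_twist (hsymm : μ.map (fun h => -h) = μ) {J : Config n → ℝ} {ε : Config n}
    (hJ : ∀ σ, J (twist ε σ) = J σ) (σ : Config n) :
    siteProb μ J (twist ε σ) = siteProb μ J σ := by
  have field_invariant : MeasurePreserving (fun (h : Fin n → ℝ) i => spin (ε i) * h i)
      (Measure.pi fun _ => μ) (Measure.pi fun _ => μ) := by
    refine measurePreserving_pi (f := fun i x => spin (ε i) * x) _ _ fun i =>
      ⟨by fun_prop, ?_⟩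
    cases ε i
    · simpa [spin] using hsymm
    · simp [spin]
  unfold siteProb
  conv_lhs => rw [← field_invariant.map_eq]
  rw [integral_map field_invariant.measurable.aemeasurable
    (measurable_gibbsProb J _).aestronglyMeasurable]
  simp_rw [gibbsProb_twist hJ]

theorem measurePreserving_twist_fieldLaw (hsymm : μ.map (fun h => -h) = μ) {J : Config n → ℝ}
    {ε : Config n} (hJ : ∀ σ, J (twist ε σ) = J σ) :
    MeasurePreserving (twist ε) (fieldLaw μ J) (fieldLaw μ J) := by
  refine ⟨.of_discrete, Measure.ext_of_singleton fun σ => ?_⟩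
  rw [Measure.map_apply .of_discrete (measurableSet_singleton σ), preimage_twist_singleton,
    fieldLaw_singleton, fieldLaw_singleton, siteProb_twist hsymm hJ]

theorem siteProb_zero (hsymm : μ.map (fun h => -h) = μ) (σ : Config n) :
    siteProb μ (fun _ => 0) σ = (1 / 2) ^ n := by
  have siteProb_const : ∀ τ : Config n, siteProb μ (fun _ => 0) τ = siteProb μ (fun _ => 0) σ :=
    fun τ => by
      have := siteProb_twist hsymm (J := fun _ => 0) (ε := twist σ τ) (fun _ => rfl) σ
      rwa [twist_comm, twist_twist] at this
  have total := sum_siteProb μ (fun _ : Config n => 0)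
  simp only [siteProb_const, Finset.sum_const, Finset.card_univ, Fintype.card_fun,
    Fintype.card_bool, Fintype.card_fin, nsmul_eq_mul, Nat.cast_pow, Nat.cast_ofNat] at total
  rw [one_div, inv_pow]
  exact eq_inv_of_mul_eq_one_right total

theorem nullLaw_eq_uniformSpins (hsymm : μ.map (fun h => -h) = μ) (n : ℕ) :
    nullLaw n μ = uniformSpins n := by
  refine Measure.ext_of_singleton fun σ => ?_
  rw [nullLaw, fieldLaw_singleton, siteProb_zero hsymm, uniformSpins, Measure.pi_singleton]
  simp only [fairCoin_singleton, Finset.prod_const, Finset.card_univ, Fintype.card_fin]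
  rw [ENNReal.ofReal_pow (by norm_num), one_div, ENNReal.ofReal_inv_of_pos two_pos]
  simp

theorem integral_cliqueLaw_resample (hsymm : μ.map (fun h => -h) = μ) {E : Type*}
    [NormedAddCommGroup E] [NormedSpace ℝ E] [CompleteSpace E] (θ : ℝ) (S : Finset (Fin n))
    (f : Config n → E) :
    ∫ σ, f σ ∂(cliqueLaw μ θ S)
      = ∫ σ, ∫ ε, f (S.piecewise σ ε) ∂(uniformSpins n) ∂(cliqueLaw μ θ S) := by
  let off : Config n → Config n := fun ε => S.piecewise (fun _ => true) ε
  have off_invariant (ε) :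
      ∫ σ, f (twist (off ε) σ) ∂(cliqueLaw μ θ S) = ∫ σ, f σ ∂(cliqueLaw μ θ S) :=
    integral_comp_of_measurePreserving (measurePreserving_twist_fieldLaw hsymm
      (cliqueInteraction_twist θ S fun i hi => S.piecewise_eq_of_mem (fun _ => true) ε hi)) f
  have twist_off (σ ε) : twist (off ε) σ = S.piecewise σ (twist σ ε) := by
    funext i
    by_cases hi : i ∈ S <;> simp [twist, off, hi, Bool.beq_comm]
  have null_invariant (σ) : ∫ ε, f (S.piecewise σ (twist σ ε)) ∂(uniformSpins n)
      = ∫ ε, f (S.piecewise σ ε) ∂(uniformSpins n) :=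
    integral_comp_of_measurePreserving (measurePreserving_twist_uniformSpins σ)
      fun ε => f (S.piecewise σ ε)
  calc ∫ σ, f σ ∂(cliqueLaw μ θ S)
      = ∫ ε, ∫ σ, f (twist (off ε) σ) ∂(cliqueLaw μ θ S) ∂(uniformSpins n) := by
        simp [off_invariant]
    _ = ∫ σ, ∫ ε, f (twist (off ε) σ) ∂(uniformSpins n) ∂(cliqueLaw μ θ S) :=
        integral_integral_swap .of_finite
    _ = _ := by simp_rw [twist_off, null_invariant]

end FieldLaw

/-! ### Sums of uniform spins -/

theorem integral_abs_le_sqrt_integral_sq {Ω : Type*} [MeasurableSpace Ω] {P : Measure Ω}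
    [IsProbabilityMeasure P] {f : Ω → ℝ} (hf : MemLp f 2 P) :
    ∫ ω, |f ω| ∂P ≤ √(∫ ω, f ω ^ 2 ∂P) := by
  have hvar := variance_nonneg |f| P
  rw [variance_eq_sub hf.abs] at hvar
  simp only [Pi.pow_apply, Pi.abs_apply, sq_abs] at hvar
  exact Real.le_sqrt_of_sq_le (by linarith)

section UniformSpins

variable {n : ℕ}

theorem iIndepFun_spin :
    iIndepFun (fun (i : Fin n) (σ : Config n) => spin (σ i)) (uniformSpins n) :=
  iIndepFun_pi fun _ => Measurable.of_discrete.aemeasurable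

theorem integral_comp_apply_uniformSpins {E : Type*} [NormedAddCommGroup E] [NormedSpace ℝ E]
    (i : Fin n) (f : Bool → E) : ∫ σ, f (σ i) ∂(uniformSpins n) = ∫ b, f b ∂fairCoin :=
  integral_comp_of_measurePreserving (measurePreserving_eval (fun _ => fairCoin) i) f

theorem integral_spin_uniformSpins (i : Fin n) : ∫ σ, spin (σ i) ∂(uniformSpins n) = 0 := by
  rw [integral_comp_apply_uniformSpins i spin, integral_fairCoin]
  simp [spin]

theorem integral_sum_spin_sq (A : Finset (Fin n)) :
    ∫ σ, (∑ i ∈ A, spin (σ i)) ^ 2 ∂(uniformSpins n) = A.card := by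
  have variance_spin (i : Fin n) : Var[fun σ => spin (σ i); uniformSpins n] = 1 := by
    rw [variance_of_integral_eq_zero .of_discrete (integral_spin_uniformSpins i)]
    simp [sq, spin_mul_self]
  have mean_sum : ∫ σ, ∑ i ∈ A, spin (σ i) ∂(uniformSpins n) = 0 := by
    rw [integral_finsetSum _ fun _ _ => .of_finite]
    simp [integral_spin_uniformSpins]
  have variance_sum := IndepFun.variance_sum (μ := uniformSpins n)
    (X := fun (i : Fin n) (σ : Config n) => spin (σ i)) (s := A) (fun _ _ => .of_discrete)
    fun i _ j _ hij => iIndepFun_spin.indepFun hij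
  rw [← variance_of_integral_eq_zero .of_discrete mean_sum]
  simpa [variance_spin, Finset.sum_fn] using variance_sum

theorem integral_abs_sum_spin_le (A : Finset (Fin n)) :
    ∫ σ, |∑ i ∈ A, spin (σ i)| ∂(uniformSpins n) ≤ √A.card := by
  rw [← integral_sum_spin_sq A]
  exact integral_abs_le_sqrt_integral_sq .of_discrete

theorem hasSubgaussianMGF_sum_spin (A : Finset (Fin n)) :
    HasSubgaussianMGF (fun σ => ∑ i ∈ A, spin (σ i)) A.card (uniformSpins n) := by
  have subgaussian_spin (i : Fin n) :
      HasSubgaussianMGF (fun σ : Config n => spin (σ i)) 1 (uniformSpins n) := by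
    have := hasSubgaussianMGF_of_mem_Icc_of_integral_eq_zero (a := -1) (b := 1)
      Measurable.of_discrete.aemeasurable
      (Eventually.of_forall fun σ => abs_le.1 (abs_spin _).le) (integral_spin_uniformSpins i)
    norm_num at this
    exact this
  simpa using HasSubgaussianMGF.sum_of_iIndepFun (s := A) iIndepFun_spin
    fun i _ => subgaussian_spin i

theorem integral_exp_abs_sum_spin_le (A : Finset (Fin n)) (t : ℝ) :
    ∫ σ, Real.exp (t * |∑ i ∈ A, spin (σ i)|) ∂(uniformSpins n)
      ≤ 2 * Real.exp (A.card * t ^ 2 / 2) := by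
  have h := hasSubgaussianMGF_sum_spin A
  calc ∫ σ, Real.exp (t * |∑ i ∈ A, spin (σ i)|) ∂(uniformSpins n)
      ≤ ∫ σ, (Real.exp (t * ∑ i ∈ A, spin (σ i)) + Real.exp (-t * ∑ i ∈ A, spin (σ i)))
          ∂(uniformSpins n) := by
        refine integral_mono .of_finite .of_finite fun σ => ?_
        rcases abs_choice (∑ i ∈ A, spin (σ i)) with h | h <;> simp only [h, mul_neg, neg_mul] <;>
          linarith [Real.exp_pos (t * ∑ i ∈ A, spin (σ i)),
            Real.exp_pos (-(t * ∑ i ∈ A, spin (σ i)))]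
    _ = mgf (fun σ => ∑ i ∈ A, spin (σ i)) (uniformSpins n) t
          + mgf (fun σ => ∑ i ∈ A, spin (σ i)) (uniformSpins n) (-t) :=
        integral_add .of_finite .of_finite
    _ ≤ Real.exp (A.card * t ^ 2 / 2) + Real.exp (A.card * (-t) ^ 2 / 2) :=
        add_le_add (h.mgf_le t) (h.mgf_le (-t))
    _ = 2 * Real.exp (A.card * t ^ 2 / 2) := by rw [neg_sq, two_mul]

theorem charFun_map_inv_sqrt_mul_sum_spin (t : ℝ) :
    charFun ((uniformSpins n).map fun σ => (√n)⁻¹ * ∑ i, spin (σ i)) t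
      = charFun (fairCoin.map spin) ((√n)⁻¹ * t) ^ n := by
  have map_spin (i : Fin n) : (uniformSpins n).map (fun σ => spin (σ i)) = fairCoin.map spin := by
    rw [← (measurePreserving_eval (fun _ => fairCoin) i).map_eq,
      Measure.map_map .of_discrete .of_discrete]
    rfl
  rw [charFun_map_mul_comp Measurable.of_discrete.aemeasurable,
    iIndepFun_spin.charFun_map_fun_sum_eq_prod fun _ => Measurable.of_discrete.aemeasurable]
  simp [map_spin]

theorem tendstoInDistribution_inv_sqrt_mul_sum_spin :
    TendstoInDistribution (fun n (σ : Config n) => (√n)⁻¹ * ∑ i, spin (σ i)) atTop id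
      uniformSpins (gaussianReal 0 1) where
  forall_aemeasurable _ := Measurable.of_discrete.aemeasurable
  tendsto := by
    refine ProbabilityMeasure.tendsto_iff_tendsto_charFun.2 fun t => ?_
    have coin_mean : fairCoin[spin] = 0 := by simp [integral_fairCoin, spin]
    have coin_sq : fairCoin[spin ^ 2] = 1 := by
      rw [integral_fairCoin]; norm_num [spin]
    simpa [charFun_map_inv_sqrt_mul_sum_spin, charFun_gaussianReal, neg_div] using
      tendsto_charFun_inv_sqrt_mul_pow Measurable.of_discrete.aemeasurable coin_mean coin_sq t

end UniformSpins

/-! ### The mean-field equation -/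

section Hyperbolic

theorem hasDerivAt_tanh (x : ℝ) : HasDerivAt Real.tanh ((1 / Real.cosh x) ^ 2) x := by
  have h := (Real.hasDerivAt_sinh x).div (Real.hasDerivAt_cosh x) (Real.cosh_pos x).ne'
  rw [show Real.tanh = Real.sinh / Real.cosh from funext Real.tanh_eq_sinh_div_cosh]
  convert! h using 1
  rw [div_pow, one_pow]
  congr 1
  linear_combination -Real.cosh_sq x

theorem continuous_tanh : Continuous Real.tanh :=
  continuous_iff_continuousAt.2 fun x => (hasDerivAt_tanh x).continuousAt

theorem sech_sq_pos (x : ℝ) : 0 < (1 / Real.cosh x) ^ 2 := by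
  have := Real.cosh_pos x; positivity

theorem abs_sech_sq_le_one (x : ℝ) : |(1 / Real.cosh x) ^ 2| ≤ 1 := by
  rw [abs_of_pos (sech_sq_pos x), div_pow, one_pow]
  exact div_le_one_of_le₀ (one_le_pow₀ (Real.one_le_cosh x)) (sq_nonneg _)

theorem continuous_sech_sq : Continuous fun x => (1 / Real.cosh x) ^ 2 := by
  have : ∀ x : ℝ, Real.cosh x ≠ 0 := fun x => (Real.cosh_pos x).ne'
  fun_prop (disch := assumption)

theorem hasDerivAt_log_cosh (x : ℝ) :
    HasDerivAt (fun y => Real.log (Real.cosh y)) (Real.tanh x) x := by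
  rw [Real.tanh_eq_sinh_div_cosh]
  exact (Real.hasDerivAt_cosh x).log (Real.cosh_pos x).ne'

theorem continuous_log_cosh : Continuous fun y => Real.log (Real.cosh y) :=
  continuous_iff_continuousAt.2 fun x => (hasDerivAt_log_cosh x).continuousAt

theorem abs_log_cosh_sub_le (a b : ℝ) :
    |Real.log (Real.cosh a) - Real.log (Real.cosh b)| ≤ |a - b| := by
  simpa using convex_univ.norm_image_sub_le_of_norm_hasDerivWithin_le (C := 1)
    (fun x _ => (hasDerivAt_log_cosh x).hasDerivWithinAt)
    (fun x _ => (Real.abs_tanh_lt_one x).le) (Set.mem_univ b) (Set.mem_univ a)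

end Hyperbolic

/-- The map `y ↦ E[tanh (θ y + h)]`, whose positive fixed points are the `positiveSolutions`. -/
noncomputable def meanTanh (μ : Measure ℝ) (θ y : ℝ) : ℝ := ∫ h, Real.tanh (θ * y + h) ∂μ

/-- The limiting free energy of a clique, as a function of its magnetization `y`. The term
`log (cosh h)` makes the integrand bounded, so that no integrability of `μ` is needed. -/
noncomputable def freeEnergy (μ : Measure ℝ) (θ y : ℝ) : ℝ :=
  θ * y ^ 2 / 2 - ∫ h, (Real.log (Real.cosh (θ * y + h)) - Real.log (Real.cosh h)) ∂μ

section MeanField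

variable {μ : Measure ℝ} {θ : ℝ}

theorem integral_comp_neg_of_symm (hsymm : μ.map (fun h => -h) = μ) {f : ℝ → ℝ}
    (hf : Continuous f) : ∫ h, f (-h) ∂μ = ∫ h, f h ∂μ := by
  conv_rhs => rw [← hsymm]
  rw [integral_map (by fun_prop) hf.aestronglyMeasurable]

theorem meanTanh_zero (hsymm : μ.map (fun h => -h) = μ) : meanTanh μ θ 0 = 0 := by
  have := integral_comp_neg_of_symm hsymm continuous_tanh
  simp only [Real.tanh_neg, integral_neg] at this
  simp only [meanTanh, mul_zero, zero_add]
  linarith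

theorem freeEnergy_abs (hsymm : μ.map (fun h => -h) = μ) (y : ℝ) :
    freeEnergy μ θ |y| = freeEnergy μ θ y := by
  have freeEnergy_neg : freeEnergy μ θ (-y) = freeEnergy μ θ y := by
    have reflect := integral_comp_neg_of_symm hsymm
      (f := fun h => Real.log (Real.cosh (θ * y + h)) - Real.log (Real.cosh h))
      ((continuous_log_cosh.comp (by fun_prop)).sub continuous_log_cosh)
    rw [freeEnergy, freeEnergy, ← reflect, neg_sq]
    congr 2
    funext h
    rw [Real.cosh_neg, ← Real.cosh_neg (θ * y + -h)]
    ring_nf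
  rcases abs_choice y with h | h <;> rw [h]
  exact freeEnergy_neg

theorem hasDerivAt_integral_comp_mul_add [IsFiniteMeasure μ] {F F' g : ℝ → ℝ} {C : ℝ}
    (hF : ∀ x, HasDerivAt F (F' x) x) (hF' : Continuous F') (hC : ∀ x, |F' x| ≤ C)
    (hint : ∀ y, Integrable (fun h => F (θ * y + h) - g h) μ) (y : ℝ) :
    HasDerivAt (fun y => ∫ h, (F (θ * y + h) - g h) ∂μ) (θ * ∫ h, F' (θ * y + h) ∂μ) y := by
  have measurable_deriv : AEStronglyMeasurable (fun h => θ * F' (θ * y + h)) μ :=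
    (show Continuous fun h => θ * F' (θ * y + h) by fun_prop).aestronglyMeasurable
  rw [← integral_const_mul]
  refine (hasDerivAt_integral_of_dominated_loc_of_deriv_le (s := Set.univ)
    (F' := fun z h => θ * F' (θ * z + h)) (bound := fun _ => |θ| * C) univ_mem
    (.of_forall fun z => (hint z).aestronglyMeasurable) (hint y) measurable_deriv
    (.of_forall fun h z _ => ?_) (integrable_const _) (.of_forall fun h z _ => ?_)).2
  · rw [norm_mul]
    exact mul_le_mul_of_nonneg_left (hC _) (abs_nonneg θ)
  · have inner : HasDerivAt (fun z : ℝ => θ * z + h) θ z := by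
      simpa using ((hasDerivAt_id z).const_mul θ).add_const h
    rw [mul_comm θ]
    exact ((hF _).comp z inner).sub_const _

variable [IsProbabilityMeasure μ]

theorem integrable_tanh (a : ℝ) : Integrable (fun h => Real.tanh (a + h)) μ :=
  .of_bound (C := 1) (continuous_tanh.comp (by fun_prop)).aestronglyMeasurable
    (.of_forall fun _ => (Real.abs_tanh_lt_one _).le)

theorem integrable_log_cosh_sub (a b : ℝ) :
    Integrable (fun h => Real.log (Real.cosh (a + h)) - Real.log (Real.cosh (b + h))) μ :=
  .of_bound (C := |a - b|)
    ((continuous_log_cosh.comp (by fun_prop)).sub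
      (continuous_log_cosh.comp (by fun_prop))).aestronglyMeasurable
    (.of_forall fun h => (abs_log_cosh_sub_le _ _).trans (by simp))

theorem hasDerivAt_meanTanh (y : ℝ) :
    HasDerivAt (meanTanh μ θ) (θ * ∫ h, (1 / Real.cosh (θ * y + h)) ^ 2 ∂μ) y := by
  simpa [meanTanh] using! hasDerivAt_integral_comp_mul_add (μ := μ) (g := 0) hasDerivAt_tanh
    continuous_sech_sq abs_sech_sq_le_one (by simpa using fun y => integrable_tanh (θ * y)) y

theorem continuous_meanTanh : Continuous (meanTanh μ θ) :=
  continuous_iff_continuousAt.2 fun y => (hasDerivAt_meanTanh y).continuousAt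

theorem hasDerivAt_freeEnergy (y : ℝ) :
    HasDerivAt (freeEnergy μ θ) (θ * (y - meanTanh μ θ y)) y := by
  have quadratic : HasDerivAt (fun y => θ * y ^ 2 / 2) (θ * y) y := by
    convert! ((hasDerivAt_pow 2 y).const_mul θ).div_const 2 using 1
    simp; ring
  have log_partition := hasDerivAt_integral_comp_mul_add (μ := μ) (θ := θ) hasDerivAt_log_cosh
    continuous_tanh (fun x => (Real.abs_tanh_lt_one x).le)
    (fun y => by simpa using integrable_log_cosh_sub (θ * y) 0) y
  rw [mul_sub]
  exact quadratic.sub log_partition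

theorem meanSechSq_pos : 0 < meanSechSq μ := by
  have integrable : Integrable (fun h : ℝ => (1 / Real.cosh h) ^ 2) μ :=
    .of_bound (C := 1) continuous_sech_sq.aestronglyMeasurable (.of_forall abs_sech_sq_le_one)
  rw [meanSechSq, integral_pos_iff_support_of_nonneg (fun h => (sech_sq_pos h).le) integrable,
    Function.support_eq_univ fun h => (sech_sq_pos h).ne']
  simp

theorem pos_of_inv_meanSechSq_lt (hlow : 1 / meanSechSq μ < θ) : 0 < θ :=
  (one_div_pos.2 meanSechSq_pos).trans hlow

theorem meanTanh_le_one (y : ℝ) : meanTanh μ θ y ≤ 1 := by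
  simpa [meanTanh] using integral_mono (μ := μ) (integrable_tanh (θ * y))
    (integrable_const (1 : ℝ)) fun h => (Real.tanh_lt_one _).le

theorem positiveSolutions_le_one {x : ℝ} (hx : x ∈ positiveSolutions μ θ) : x ≤ 1 :=
  hx.2.trans_le (meanTanh_le_one x)

theorem exists_meanTanh_eq_self {a b : ℝ} (hab : a ≤ b) (ha : a ≤ meanTanh μ θ a)
    (hb : meanTanh μ θ b ≤ b) : ∃ z ∈ Set.Icc a b, z = meanTanh μ θ z := by
  obtain ⟨z, hz, hz0⟩ := intermediate_value_Icc' hab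
    (continuous_meanTanh.sub continuous_id).continuousOn
    (show (0 : ℝ) ∈ Set.Icc (meanTanh μ θ b - b) (meanTanh μ θ a - a) from
      ⟨sub_nonpos.2 hb, sub_nonneg.2 ha⟩)
  exact ⟨z, hz, (sub_eq_zero.1 hz0).symm⟩

-- The slope of `meanTanh` at `0` is `θ * meanSechSq μ > 1`.
theorem exists_forall_lt_meanTanh (hsymm : μ.map (fun h => -h) = μ)
    (hlow : 1 / meanSechSq μ < θ) : ∃ r > 0, ∀ y, 0 < y → y ≤ r → y < meanTanh μ θ y := by
  have slope : HasDerivAt (meanTanh μ θ) (θ * meanSechSq μ) 0 := by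
    simpa [meanSechSq] using hasDerivAt_meanTanh (μ := μ) (θ := θ) 0
  have one_lt_slope : 1 < θ * meanSechSq μ := (div_lt_iff₀ meanSechSq_pos).1 hlow
  have near := (hasDerivAt_iff_tendsto_slope.1 slope).eventually (lt_mem_nhds one_lt_slope)
  rw [eventually_nhdsWithin_iff, Metric.eventually_nhds_iff] at near
  obtain ⟨r, hr, hslope⟩ := near
  refine ⟨r / 2, half_pos hr, fun y hy hyr => ?_⟩
  have := hslope (y := y) (by rw [dist_zero_right, Real.norm_of_nonneg hy.le]; linarith) hy.ne'
  rwa [slope_def_field, meanTanh_zero hsymm, sub_zero, sub_zero, one_lt_div hy] at this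

theorem exists_isLeast_positiveSolutions (hsymm : μ.map (fun h => -h) = μ)
    (hlow : 1 / meanSechSq μ < θ) : ∃ x, IsLeast (positiveSolutions μ θ) x := by
  obtain ⟨r, hr, hlt⟩ := exists_forall_lt_meanTanh hsymm hlow
  have solutions_eq : positiveSolutions μ θ = Set.Ici r ∩ {y | y = meanTanh μ θ y} := by
    ext y
    refine ⟨fun hy => ⟨?_, hy.2⟩, fun hy => ⟨hr.trans_le hy.1, hy.2⟩⟩
    by_contra hyr
    exact (hlt y hy.1 (not_le.1 hyr).le).ne hy.2
  have closed : IsClosed (positiveSolutions μ θ) := by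
    rw [solutions_eq]
    exact isClosed_Ici.inter (isClosed_eq continuous_id continuous_meanTanh)
  obtain ⟨z, hz, hz_fixed⟩ := exists_meanTanh_eq_self (b := max r 1) (le_max_left _ _)
    (hlt r hr le_rfl).le ((meanTanh_le_one _).trans (le_max_right _ _))
  exact ⟨_, closed.isLeast_csInf ⟨z, hr.trans_le hz.1, hz_fixed⟩ ⟨0, fun y hy => hy.1.le⟩⟩

theorem lt_meanTanh_of_lt_isLeast (hsymm : μ.map (fun h => -h) = μ)
    (hlow : 1 / meanSechSq μ < θ) {x : ℝ} (hx : IsLeast (positiveSolutions μ θ) x) {y : ℝ}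
    (hy : 0 < y) (hyx : y < x) : y < meanTanh μ θ y := by
  obtain ⟨r, hr, hlt⟩ := exists_forall_lt_meanTanh hsymm hlow
  by_contra! hle
  have hry : 0 < min r y := lt_min hr hy
  obtain ⟨z, hz, hz_fixed⟩ := exists_meanTanh_eq_self (min_le_right r y)
    (hlt _ hry (min_le_left r y)).le hle
  exact (hx.2 ⟨hry.trans_le hz.1, hz_fixed⟩).not_gt (hz.2.trans_lt hyx)

theorem meanTanh_lt_of_unique {x : ℝ} (hx : x ∈ positiveSolutions μ θ)
    (huniq : ∀ y ∈ positiveSolutions μ θ, y = x) {y : ℝ} (hxy : x < y) : meanTanh μ θ y < y := by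
  by_contra! hle
  obtain ⟨z, hz, hz_fixed⟩ := exists_meanTanh_eq_self (b := max y 1) (le_max_left _ _) hle
    ((meanTanh_le_one _).trans (le_max_right _ _))
  have := huniq z ⟨hx.1.trans (hxy.trans_le hz.1), hz_fixed⟩
  linarith [hz.1]

theorem freeEnergy_strictAntiOn (hsymm : μ.map (fun h => -h) = μ)
    (hlow : 1 / meanSechSq μ < θ) {x : ℝ} (hx : IsLeast (positiveSolutions μ θ) x) :
    StrictAntiOn (freeEnergy μ θ) (Set.Icc 0 x) := by
  refine strictAntiOn_of_deriv_neg (convex_Icc 0 x)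
    (fun y _ => (hasDerivAt_freeEnergy y).continuousAt.continuousWithinAt) fun y hy => ?_
  rw [interior_Icc] at hy
  rw [(hasDerivAt_freeEnergy y).deriv]
  exact mul_neg_of_pos_of_neg (pos_of_inv_meanSechSq_lt hlow)
    (sub_neg.2 (lt_meanTanh_of_lt_isLeast hsymm hlow hx hy.1 hy.2))

theorem freeEnergy_strictMonoOn (hθ : 0 < θ) {x : ℝ} (hx : x ∈ positiveSolutions μ θ)
    (huniq : ∀ y ∈ positiveSolutions μ θ, y = x) :
    StrictMonoOn (freeEnergy μ θ) (Set.Ici x) := by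
  refine strictMonoOn_of_deriv_pos (convex_Ici x)
    (fun y _ => (hasDerivAt_freeEnergy y).continuousAt.continuousWithinAt) fun y hy => ?_
  rw [interior_Ici] at hy
  rw [(hasDerivAt_freeEnergy y).deriv]
  exact mul_pos hθ (sub_pos.2 (meanTanh_lt_of_unique hx huniq hy))

theorem freeEnergy_gap (hsymm : μ.map (fun h => -h) = μ) (hlow : 1 / meanSechSq μ < θ)
    {x τ : ℝ} (hx : IsLeast (positiveSolutions μ θ) x) (hτ : 0 ≤ τ) (hτx : τ < x) :
    ∃ δ > 0, ∀ y, |y| ≤ τ → freeEnergy μ θ x + δ ≤ freeEnergy μ θ y := by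
  have hanti := freeEnergy_strictAntiOn hsymm hlow hx
  refine ⟨freeEnergy μ θ τ - freeEnergy μ θ x,
    sub_pos.2 (hanti ⟨hτ, hτx.le⟩ ⟨hτ.trans hτx.le, le_rfl⟩ hτx), fun y hy => ?_⟩
  rw [add_sub_cancel, ← freeEnergy_abs hsymm y]
  exact hanti.antitoneOn ⟨abs_nonneg y, hy.trans hτx.le⟩ ⟨hτ, hτx.le⟩ hy

theorem freeEnergy_gap_of_unique (hsymm : μ.map (fun h => -h) = μ)
    (hlow : 1 / meanSechSq μ < θ) {x ε : ℝ} (hx : IsLeast (positiveSolutions μ θ) x)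
    (huniq : ∀ y ∈ positiveSolutions μ θ, y = x) (hε : 0 < ε) :
    ∃ δ > 0, ∀ y, ε ≤ |(|y| - x)| → freeEnergy μ θ x + δ ≤ freeEnergy μ θ y := by
  have hx0 : 0 < x := hx.1.1
  have hmono := freeEnergy_strictMonoOn (pos_of_inv_meanSechSq_lt hlow) hx.1 huniq
  obtain ⟨δ, hδ, hgap⟩ := freeEnergy_gap hsymm hlow hx (τ := max (x - ε) 0) (le_max_right _ _)
    (max_lt (by linarith) hx0)
  refine ⟨min δ (freeEnergy μ θ (x + ε) - freeEnergy μ θ x), lt_min hδ (sub_pos.2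
    (hmono Set.self_mem_Ici (by simpa using hε.le) (by linarith))), fun y hy => ?_⟩
  rcases le_abs.1 hy with hfar | hnear
  · have := hmono.monotoneOn (show x + ε ∈ Set.Ici x by simpa using hε.le)
      (show |y| ∈ Set.Ici x by simp only [Set.mem_Ici]; linarith) (by linarith)
    rw [← freeEnergy_abs hsymm y]
    linarith [min_le_right δ (freeEnergy μ θ (x + ε) - freeEnergy μ θ x)]
  · have := hgap y (le_max_of_le_left (by linarith))
    linarith [min_le_left δ (freeEnergy μ θ (x + ε) - freeEnergy μ θ x)]

end MeanField

/-! ### Large deviations of the clique magnetization -/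

section LargeDeviations

/-- The contribution of one site with external field `h` to `freeEnergy`. -/
noncomputable def siteFreeEnergy (θ y h : ℝ) : ℝ :=
  θ * y ^ 2 / 2 - (Real.log (Real.cosh (θ * y + h)) - Real.log (Real.cosh h))

/-- The tangent to `cliqueInteraction`, as a function of the magnetization, at `y`. -/
noncomputable def tangentInteraction {n : ℕ} (θ y : ℝ) (S : Finset (Fin n)) (σ : Config n) : ℝ :=
  θ * y * ∑ i ∈ S, spin (σ i) - S.card * (θ * y ^ 2 / 2)

theorem continuous_siteFreeEnergy (θ y : ℝ) : Continuous (siteFreeEnergy θ y) :=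
  continuous_const.sub ((continuous_log_cosh.comp (by fun_prop)).sub continuous_log_cosh)

theorem abs_siteFreeEnergy_le {θ y : ℝ} (hθ : 0 ≤ θ) (hy : |y| ≤ 1) (h : ℝ) :
    |siteFreeEnergy θ y h| ≤ 3 / 2 * θ := by
  have quadratic : |θ * y ^ 2 / 2| ≤ θ / 2 := by
    rw [abs_of_nonneg (by positivity)]
    nlinarith [(sq_le_one_iff_abs_le_one y).2 hy]
  have log_ratio := abs_log_cosh_sub_le (θ * y + h) h
  rw [add_sub_cancel_right, abs_mul, abs_of_nonneg hθ] at log_ratio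
  have := mul_le_of_le_one_right hθ hy
  exact (abs_sub _ _).trans (by linarith)

theorem integral_siteFreeEnergy {μ : Measure ℝ} [IsProbabilityMeasure μ] (θ y : ℝ) :
    ∫ h, siteFreeEnergy θ y h ∂μ = freeEnergy μ θ y := by
  have := integrable_log_cosh_sub (μ := μ) (θ * y) 0
  simp only [zero_add] at this
  simp only [siteFreeEnergy]
  rw [integral_sub (integrable_const _) this]
  simp [freeEnergy]

variable {n : ℕ}

theorem cliqueInteraction_sub_tangentInteraction (θ y : ℝ) (S : Finset (Fin n)) (σ : Config n) :
    cliqueInteraction θ S σ - tangentInteraction θ y S σ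
      = θ * S.card / 2 * (magnetization S σ - y) ^ 2 := by
  rcases S.eq_empty_or_nonempty with rfl | hS
  · simp [cliqueInteraction, tangentInteraction]
  · have : (S.card : ℝ) ≠ 0 := by exact_mod_cast hS.card_pos.ne'
    unfold cliqueInteraction tangentInteraction magnetization
    field_simp
    ring

theorem tangentInteraction_le_cliqueInteraction {θ : ℝ} (hθ : 0 ≤ θ) (y : ℝ)
    (S : Finset (Fin n)) (σ : Config n) :
    tangentInteraction θ y S σ ≤ cliqueInteraction θ S σ := by
  rw [← sub_nonneg, cliqueInteraction_sub_tangentInteraction]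
  positivity

theorem tangentInteraction_magnetization (θ : ℝ) (S : Finset (Fin n)) (σ : Config n) :
    tangentInteraction θ (magnetization S σ) S σ = cliqueInteraction θ S σ := by
  have := cliqueInteraction_sub_tangentInteraction θ (magnetization S σ) S σ
  rw [sub_self, zero_pow two_ne_zero, mul_zero] at this
  linarith

theorem sum_exp_sum_mul_spin (h : Fin n → ℝ) :
    ∑ σ : Config n, Real.exp (∑ i, h i * spin (σ i)) = ∏ i, 2 * Real.cosh (h i) := by
  simp_rw [Real.exp_sum]
  rw [← Fintype.prod_sum (fun i b => Real.exp (h i * spin b))]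
  refine Finset.prod_congr rfl fun i _ => ?_
  rw [Real.cosh_eq]
  simp [spin]
  ring

theorem cosh_mul_add_eq (θ y h : ℝ) :
    Real.cosh (θ * y + h) = Real.cosh h * Real.exp (θ * y ^ 2 / 2 - siteFreeEnergy θ y h) := by
  rw [siteFreeEnergy, sub_sub_cancel, Real.exp_sub, Real.exp_log (Real.cosh_pos _),
    Real.exp_log (Real.cosh_pos _), mul_div_cancel₀ _ (Real.cosh_pos h).ne']

theorem sum_exp_tangentInteraction (θ y : ℝ) (S : Finset (Fin n)) (h : Fin n → ℝ) :
    ∑ σ : Config n, Real.exp (tangentInteraction θ y S σ + ∑ i, h i * spin (σ i))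
      = (∏ i, 2 * Real.cosh (h i)) * Real.exp (-∑ i ∈ S, siteFreeEnergy θ y (h i)) := by
  have shifted_field (σ : Config n) :
      tangentInteraction θ y S σ + ∑ i, h i * spin (σ i)
        = -(S.card * (θ * y ^ 2 / 2)) + ∑ i, (if i ∈ S then θ * y + h i else h i) * spin (σ i) := by
    have split (i : Fin n) : (if i ∈ S then θ * y + h i else h i) * spin (σ i)
        = (if i ∈ S then θ * y * spin (σ i) else 0) + h i * spin (σ i) := by
      split_ifs <;> ring
    simp_rw [split, Finset.sum_add_distrib, Finset.sum_ite_mem, Finset.univ_inter,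
      ← Finset.mul_sum, tangentInteraction]
    ring
  have site (i : Fin n) : 2 * Real.cosh (if i ∈ S then θ * y + h i else h i)
      = 2 * Real.cosh (h i) *
        if i ∈ S then Real.exp (θ * y ^ 2 / 2 - siteFreeEnergy θ y (h i)) else 1 := by
    split_ifs
    · rw [cosh_mul_add_eq, mul_assoc]
    · rw [mul_one]
  simp_rw [shifted_field, Real.exp_add, ← Finset.mul_sum, sum_exp_sum_mul_spin, site,
    Finset.prod_mul_distrib, Finset.prod_ite_mem, Finset.univ_inter, ← Real.exp_sum,
    Finset.sum_sub_distrib, Finset.sum_const, nsmul_eq_mul]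
  rw [mul_left_comm, ← Real.exp_add]
  ring_nf

-- On `{magnetization S = y}` the interaction agrees with its tangent at `y`, while the partition
-- function dominates the one obtained from the tangent at any `x`.
theorem sum_gibbsProb_magnetization_eq_le {θ : ℝ} (hθ : 0 ≤ θ) (x y : ℝ) (S : Finset (Fin n))
    (h : Fin n → ℝ) :
    ∑ σ with magnetization S σ = y, gibbsProb (cliqueInteraction θ S) h σ
      ≤ Real.exp (∑ i ∈ S, (siteFreeEnergy θ x (h i) - siteFreeEnergy θ y (h i))) := by
  set Z := ∑ σ : Config n, Real.exp (cliqueInteraction θ S σ + ∑ i, h i * spin (σ i)) with hZ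
  have Z_pos : 0 < Z := Finset.sum_pos (fun _ _ => Real.exp_pos _) Finset.univ_nonempty
  have le_Z : ∑ σ : Config n, Real.exp (tangentInteraction θ x S σ + ∑ i, h i * spin (σ i)) ≤ Z :=
    Finset.sum_le_sum fun σ _ => Real.exp_le_exp.2
      (add_le_add_left (tangentInteraction_le_cliqueInteraction hθ x S σ) _)
  simp only [gibbsProb, ← hZ]
  rw [← Finset.sum_div, div_le_iff₀ Z_pos]
  calc ∑ σ with magnetization S σ = y,
        Real.exp (cliqueInteraction θ S σ + ∑ i, h i * spin (σ i))
      = ∑ σ with magnetization S σ = y,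
        Real.exp (tangentInteraction θ y S σ + ∑ i, h i * spin (σ i)) := by
        refine Finset.sum_congr rfl fun σ hσ => ?_
        rw [← tangentInteraction_magnetization, (Finset.mem_filter.1 hσ).2]
    _ ≤ ∑ σ : Config n, Real.exp (tangentInteraction θ y S σ + ∑ i, h i * spin (σ i)) :=
        Finset.sum_le_sum_of_subset_of_nonneg (Finset.filter_subset _ _)
          fun _ _ _ => (Real.exp_pos _).le
    _ = Real.exp (∑ i ∈ S, (siteFreeEnergy θ x (h i) - siteFreeEnergy θ y (h i))) *
        ∑ σ : Config n, Real.exp (tangentInteraction θ x S σ + ∑ i, h i * spin (σ i)) := by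
        rw [sum_exp_tangentInteraction, sum_exp_tangentInteraction, mul_left_comm, ← Real.exp_add,
          Finset.sum_sub_distrib]
        ring_nf
    _ ≤ _ := mul_le_mul_of_nonneg_left le_Z (Real.exp_pos _).le

theorem integral_exp_mul_le_of_abs_le {Ω : Type*} [MeasurableSpace Ω] {P : Measure Ω}
    [IsProbabilityMeasure P] {X : Ω → ℝ} {B δ l : ℝ} (hX : AEMeasurable X P)
    (hB : ∀ ω, |X ω| ≤ B) (hδ : ∫ ω, X ω ∂P ≤ -δ) (hl : 0 ≤ l) :
    ∫ ω, Real.exp (l * X ω) ∂P ≤ Real.exp (B ^ 2 * l ^ 2 / 2 - l * δ) := by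
  have hoeffding := (hasSubgaussianMGF_of_mem_Icc hX
    (.of_forall fun ω => abs_le.1 (hB ω))).mgf_le l
  have B_nonneg : 0 ≤ B := by
    obtain ⟨ω⟩ := nonempty_of_isProbabilityMeasure P
    exact (abs_nonneg _).trans (hB ω)
  have half_width : ((‖B - -B‖₊ / 2) ^ 2 : ℝ≥0) * l ^ 2 / 2 = B ^ 2 * l ^ 2 / 2 := by
    push_cast
    rw [Real.norm_of_nonneg (by linarith)]
    ring
  have mean : l * ∫ ω, X ω ∂P ≤ -(l * δ) := by
    linarith [mul_le_mul_of_nonneg_left hδ hl]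
  have recenter (ω : Ω) : Real.exp (l * X ω)
      = Real.exp (l * ∫ ω, X ω ∂P) * Real.exp (l * (X ω - ∫ ω, X ω ∂P)) := by
    rw [← Real.exp_add]; ring_nf
  rw [mgf, half_width] at hoeffding
  simp_rw [recenter]
  rw [integral_const_mul, sub_eq_neg_add, Real.exp_add]
  exact mul_le_mul (Real.exp_le_exp.2 mean) hoeffding (integral_nonneg fun _ => (Real.exp_pos _).le)
    (Real.exp_pos _).le

theorem integral_prod_comp_pi {μ : Measure ℝ} [IsProbabilityMeasure μ] (S : Finset (Fin n))
    (f : ℝ → ℝ) :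
    ∫ h, ∏ i ∈ S, f (h i) ∂(Measure.pi fun _ : Fin n => μ) = (∫ z, f z ∂μ) ^ S.card := by
  have extend (h : Fin n → ℝ) : ∏ i ∈ S, f (h i) = ∏ i, (if i ∈ S then f (h i) else 1) := by
    rw [Finset.prod_ite_mem, Finset.univ_inter]
  have factor (i : Fin n) : ∫ z, (if i ∈ S then f z else 1) ∂μ
      = if i ∈ S then ∫ z, f z ∂μ else 1 := by split_ifs <;> simp
  simp_rw [extend]
  rw [integral_fintype_prod_eq_prod (f := fun i z => if i ∈ S then f z else 1)]
  simp_rw [factor, Finset.prod_ite_mem, Finset.univ_inter, Finset.prod_const]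

variable {μ : Measure ℝ} [IsProbabilityMeasure μ]

theorem real_fieldLaw (J : Config n → ℝ) (p : Config n → Prop) [DecidablePred p] :
    (fieldLaw μ J).real {σ | p σ}
      = ∫ h, ∑ σ with p σ, gibbsProb J h σ ∂(Measure.pi fun _ : Fin n => μ) := by
  have singleton (σ : Config n) : (fieldLaw μ J).real {σ} = siteProb μ J σ := by
    rw [measureReal_def, fieldLaw_singleton]
    exact ENNReal.toReal_ofReal (integral_nonneg fun h => gibbsProb_nonneg J h σ)
  rw [integral_finsetSum _ fun σ _ => integrable_gibbsProb μ J σ,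
    show {σ | p σ} = ((Finset.univ.filter p : Finset (Config n)) : Set (Config n)) by simp,
    ← sum_measureReal_singleton]
  exact Finset.sum_congr rfl fun σ _ => singleton σ

-- A probability is at most its `l`-th power when `l ≤ 1`, which makes the quenched bound
-- integrable against the field with a small exponent.
theorem cliqueLaw_magnetization_eq_le {θ x y l : ℝ} (hθ : 0 ≤ θ) (hx : |x| ≤ 1) (hy : |y| ≤ 1)
    (hl0 : 0 ≤ l) (hl1 : l ≤ 1) (S : Finset (Fin n)) :
    (cliqueLaw μ θ S).real {σ | magnetization S σ = y}
      ≤ (∫ h, Real.exp (l * (siteFreeEnergy θ x h - siteFreeEnergy θ y h)) ∂μ) ^ S.card := by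
  set D : ℝ → ℝ := fun h => siteFreeEnergy θ x h - siteFreeEnergy θ y h
  have D_continuous : Continuous D :=
    (continuous_siteFreeEnergy θ x).sub (continuous_siteFreeEnergy θ y)
  have D_le (h : ℝ) : D h ≤ 3 * θ := by
    linarith [(abs_le.1 (abs_siteFreeEnergy_le hθ hx h)).2,
      (abs_le.1 (abs_siteFreeEnergy_le hθ hy h)).1]
  have quenched (h : Fin n → ℝ) :
      ∑ σ with magnetization S σ = y, gibbsProb (cliqueInteraction θ S) h σ
        ≤ ∏ i ∈ S, Real.exp (l * D (h i)) := by
    rw [← Real.exp_sum, ← Finset.mul_sum]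
    rcases le_total 0 (∑ i ∈ S, D (h i)) with hD | hD
    · refine le_trans ?_ (Real.one_le_exp (mul_nonneg hl0 hD))
      rw [← sum_gibbsProb (cliqueInteraction θ S) h]
      exact Finset.sum_le_sum_of_subset_of_nonneg (Finset.filter_subset _ _)
        fun σ _ _ => gibbsProb_nonneg _ _ σ
    · refine (sum_gibbsProb_magnetization_eq_le hθ x y S h).trans (Real.exp_le_exp.2 ?_)
      exact (one_mul (∑ i ∈ S, D (h i))).ge.trans (mul_le_mul_of_nonpos_right hl1 hD)
  have bound_integrable : Integrable (fun h : Fin n → ℝ => ∏ i ∈ S, Real.exp (l * D (h i)))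
      (Measure.pi fun _ => μ) := by
    refine .of_bound (C := ∏ i ∈ S, Real.exp (l * (3 * θ)))
      (Continuous.aestronglyMeasurable (by fun_prop)) (.of_forall fun h => ?_)
    rw [Real.norm_of_nonneg (Finset.prod_nonneg fun _ _ => (Real.exp_pos _).le)]
    gcongr
    exact D_le _
  rw [cliqueLaw, real_fieldLaw, ← integral_prod_comp_pi]
  exact integral_mono (integrable_finsetSum _ fun σ _ => integrable_gibbsProb μ _ σ)
    bound_integrable quenched

theorem exists_magnetization_eq (S : Finset (Fin n)) (σ : Config n) :
    ∃ j ∈ Finset.range (S.card + 1), magnetization S σ = (2 * j - S.card) / S.card := by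
  refine ⟨(S.filter fun i => σ i = true).card,
    Finset.mem_range.2 (Nat.lt_succ_of_le (Finset.card_filter_le _ _)), ?_⟩
  have spin_eq (i : Fin n) : spin (σ i) = 2 * (if σ i = true then 1 else 0) - 1 := by
    cases σ i <;> simp [spin]; norm_num
  simp_rw [magnetization, spin_eq]
  rw [Finset.sum_sub_distrib, ← Finset.mul_sum, Finset.sum_boole]
  simp

theorem exists_cliqueLaw_magnetization_eq_le {θ x δ : ℝ} (hθ : 0 < θ) (hx : |x| ≤ 1)
    (hδ : 0 < δ) :
    ∃ c > 0, ∀ (n : ℕ) (S : Finset (Fin n)) (y : ℝ), |y| ≤ 1 →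
      freeEnergy μ θ x + δ ≤ freeEnergy μ θ y →
      (cliqueLaw μ θ S).real {σ | magnetization S σ = y} ≤ Real.exp (-c * S.card) := by
  -- With this `l`, the exponent `(3θ)² l² / 2 - l δ` of the Hoeffding bound is at most `-l δ / 2`.
  obtain ⟨l, hl0, hl1, hl⟩ : ∃ l > 0, l ≤ 1 ∧ l * (3 * θ) ^ 2 ≤ δ :=
    ⟨min 1 (δ / (3 * θ) ^ 2), by positivity, min_le_left _ _,
      (le_div_iff₀ (by positivity)).1 (min_le_right _ _)⟩
  refine ⟨l * δ / 2, by positivity, fun n S y hy hgap => ?_⟩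
  have integrable_site {z : ℝ} (hz : |z| ≤ 1) : Integrable (siteFreeEnergy θ z) μ :=
    .of_bound (C := 3 / 2 * θ) (continuous_siteFreeEnergy θ z).aestronglyMeasurable
      (.of_forall (abs_siteFreeEnergy_le hθ.le hz))
  have bounded (h : ℝ) : |siteFreeEnergy θ x h - siteFreeEnergy θ y h| ≤ 3 * θ :=
    (abs_sub _ _).trans (by
      linarith [abs_siteFreeEnergy_le hθ.le hx h, abs_siteFreeEnergy_le hθ.le hy h])
  have mean : ∫ h, (siteFreeEnergy θ x h - siteFreeEnergy θ y h) ∂μ ≤ -δ := by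
    rw [integral_sub (integrable_site hx) (integrable_site hy), integral_siteFreeEnergy,
      integral_siteFreeEnergy]
    linarith
  have annealed := integral_exp_mul_le_of_abs_le ((continuous_siteFreeEnergy θ x).sub
    (continuous_siteFreeEnergy θ y)).aemeasurable bounded mean hl0.le
  refine (cliqueLaw_magnetization_eq_le hθ.le hx hy hl0.le hl1 S).trans ?_
  rw [mul_comm, Real.exp_nat_mul]
  refine pow_le_pow_left₀ (integral_nonneg fun _ => (Real.exp_pos _).le)
    (annealed.trans (Real.exp_le_exp.2 ?_)) _
  nlinarith

theorem cliqueLaw_magnetization_mem_le {A : Set ℝ} {θ r : ℝ} (S : Finset (Fin n)) (hr : 0 ≤ r)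
    (hA : ∀ y ∈ A, |y| ≤ 1 → (cliqueLaw μ θ S).real {σ | magnetization S σ = y} ≤ r) :
    (cliqueLaw μ θ S).real {σ | magnetization S σ ∈ A} ≤ (S.card + 1) * r := by
  let v : ℕ → ℝ := fun j => (2 * j - S.card) / S.card
  have cover : {σ | magnetization S σ ∈ A} ⊆
      ⋃ j ∈ Finset.range (S.card + 1), {σ | magnetization S σ ∈ A ∧ magnetization S σ = v j} := by
    intro σ hσ
    obtain ⟨j, hj, hv⟩ := exists_magnetization_eq S σ
    exact Set.mem_biUnion (x := j) hj ⟨hσ, hv⟩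
  refine (measureReal_mono cover (measure_ne_top _ _)).trans
    ((measureReal_biUnion_finset_le _ _).trans ?_)
  refine (Finset.sum_le_card_nsmul _ _ r fun j _ => ?_).trans (by simp)
  rcases Set.eq_empty_or_nonempty {σ | magnetization S σ ∈ A ∧ magnetization S σ = v j} with
    hempty | ⟨σ, hσA, hσ⟩
  · rwa [hempty, measureReal_empty]
  · exact (measureReal_mono fun σ hσ => hσ.2).trans
      (hA _ (hσ ▸ hσA) (hσ ▸ abs_magnetization_le_one S σ))

theorem tendsto_add_one_mul_exp_neg {c : ℝ} (hc : 0 < c) :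
    Tendsto (fun k : ℕ => ((k : ℝ) + 1) * Real.exp (-c * k)) atTop (𝓝 0) := by
  have term (p : ℕ) := (Real.tendsto_pow_mul_exp_neg_atTop_nhds_zero p).comp
    (tendsto_natCast_atTop_atTop.const_mul_atTop hc)
  have := ((term 1).const_mul (1 / c)).add (term 0)
  simp only [mul_zero, add_zero] at this
  refine this.congr fun k => ?_
  simp only [Function.comp_apply, pow_one, pow_zero, one_mul, neg_mul]
  field_simp

theorem cliqueLaw_magnetization_mem_small {θ x δ η : ℝ} (hθ : 0 < θ) (hx : |x| ≤ 1) (hδ : 0 < δ)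
    (hη : 0 < η) {A : Set ℝ} (hA : ∀ y ∈ A, freeEnergy μ θ x + δ ≤ freeEnergy μ θ y) :
    ∃ K : ℕ, ∀ (n : ℕ) (S : Finset (Fin n)), K ≤ S.card →
      (cliqueLaw μ θ S).real {σ | magnetization S σ ∈ A} ≤ η := by
  obtain ⟨c, hc, hle⟩ := exists_cliqueLaw_magnetization_eq_le (μ := μ) hθ hx hδ
  obtain ⟨K, hK⟩ := eventually_atTop.1 ((tendsto_add_one_mul_exp_neg hc).eventually
    (ge_mem_nhds hη))
  exact ⟨K, fun n S hS => (cliqueLaw_magnetization_mem_le S (Real.exp_pos _).le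
    fun y hyA hy => hle n S y hy (hA y hyA)).trans (hK _ hS)⟩

theorem cliqueLaw_abs_magnetization_small (hsymm : μ.map (fun h => -h) = μ) {θ x τ η : ℝ}
    (hlow : 1 / meanSechSq μ < θ) (hx : IsLeast (positiveSolutions μ θ) x) (hτ : 0 ≤ τ)
    (hτx : τ < x) (hη : 0 < η) :
    ∃ K : ℕ, ∀ (n : ℕ) (S : Finset (Fin n)), K ≤ S.card →
      (cliqueLaw μ θ S).real {σ | |magnetization S σ| ≤ τ} ≤ η := by
  obtain ⟨δ, hδ, hgap⟩ := freeEnergy_gap hsymm hlow hx hτ hτx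
  have abs_x_le : |x| ≤ 1 := (abs_of_pos hx.1.1).trans_le (positiveSolutions_le_one hx.1)
  exact cliqueLaw_magnetization_mem_small (pos_of_inv_meanSechSq_lt hlow) abs_x_le hδ hη
    (A := {y | |y| ≤ τ}) hgap

theorem cliqueLaw_abs_magnetization_sub_small (hsymm : μ.map (fun h => -h) = μ) {θ x ε η : ℝ}
    (hlow : 1 / meanSechSq μ < θ) (hx : IsLeast (positiveSolutions μ θ) x)
    (huniq : ∀ y ∈ positiveSolutions μ θ, y = x) (hε : 0 < ε) (hη : 0 < η) :
    ∃ K : ℕ, ∀ (n : ℕ) (S : Finset (Fin n)), K ≤ S.card →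
      (cliqueLaw μ θ S).real {σ | ε ≤ |(|magnetization S σ| - x)|} ≤ η := by
  obtain ⟨δ, hδ, hgap⟩ := freeEnergy_gap_of_unique hsymm hlow hx huniq hε
  have abs_x_le : |x| ≤ 1 := (abs_of_pos hx.1.1).trans_le (positiveSolutions_le_one hx.1)
  exact cliqueLaw_magnetization_mem_small (pos_of_inv_meanSechSq_lt hlow) abs_x_le hδ hη
    (A := {y | ε ≤ |(|y| - x)|}) hgap

end LargeDeviations

/-! ### Averages over independent samples -/

/-- The average of the values of `f` at the `m` coordinates of `X`. -/
noncomputable def sampleAvg {Ω : Type*} {m : ℕ} (f : Ω → ℝ) (X : Fin m → Ω) : ℝ :=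
  (∑ j, f (X j)) / m

section SampleAvg

variable {Ω : Type*} {m : ℕ}

theorem sampleAvg_nonneg {f : Ω → ℝ} (hf : ∀ ω, 0 ≤ f ω) (X : Fin m → Ω) : 0 ≤ sampleAvg f X :=
  div_nonneg (Finset.sum_nonneg fun _ _ => hf _) (Nat.cast_nonneg _)

theorem sampleAvg_mono {f g : Ω → ℝ} (hfg : ∀ ω, f ω ≤ g ω) (X : Fin m → Ω) :
    sampleAvg f X ≤ sampleAvg g X :=
  div_le_div_of_nonneg_right (Finset.sum_le_sum fun _ _ => hfg _) (Nat.cast_nonneg _)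

variable [MeasurableSpace Ω] {P : Measure Ω} [IsProbabilityMeasure P]

theorem integrable_comp_apply_pi {f : Ω → ℝ} (hf : Integrable f P) (j : Fin m) :
    Integrable (fun X => f (X j)) (Measure.pi fun _ : Fin m => P) :=
  (measurePreserving_eval (fun _ : Fin m => P) j).integrable_comp_of_integrable hf

theorem integrable_sampleAvg {f : Ω → ℝ} (hf : Integrable f P) :
    Integrable (sampleAvg f) (Measure.pi fun _ : Fin m => P) :=
  (integrable_finsetSum _ fun j _ => integrable_comp_apply_pi hf j).div_const _

theorem integral_sampleAvg {f : Ω → ℝ} (hf : Integrable f P) (hm : 1 ≤ m) :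
    ∫ X, sampleAvg f X ∂(Measure.pi fun _ : Fin m => P) = ∫ ω, f ω ∂P := by
  have coordinate (j : Fin m) : ∫ X, f (X j) ∂(Measure.pi fun _ : Fin m => P) = ∫ ω, f ω ∂P :=
    integral_comp_eval (μ := fun _ : Fin m => P) hf.aestronglyMeasurable
  simp only [sampleAvg]
  rw [integral_div, integral_finsetSum _ fun j _ => integrable_comp_apply_pi hf j]
  simp_rw [coordinate]
  rw [Finset.sum_const, Finset.card_univ, Fintype.card_fin, nsmul_eq_mul,
    mul_div_cancel_left₀ _ (by positivity)]

theorem real_le_sampleAvg_le {f : Ω → ℝ} (hf : Integrable f P) (hf0 : ∀ ω, 0 ≤ f ω)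
    (hm : 1 ≤ m) {τ : ℝ} (hτ : 0 < τ) :
    (Measure.pi fun _ : Fin m => P).real {X | τ ≤ sampleAvg f X} ≤ (∫ ω, f ω ∂P) / τ := by
  rw [le_div_iff₀ hτ, mul_comm, ← integral_sampleAvg hf hm]
  exact mul_meas_ge_le_integral_of_nonneg (.of_forall (sampleAvg_nonneg hf0))
    (integrable_sampleAvg hf) τ

-- If the average is below `τ`, then `f < τ'` at a proportion at least `1 - τ / τ'` of the samples.
theorem real_sampleAvg_lt_le {f : Ω → ℝ} (hf : Measurable f) (hf0 : ∀ ω, 0 ≤ f ω) (hm : 1 ≤ m)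
    {τ τ' : ℝ} (hτ' : 0 < τ') (hττ' : τ < τ') :
    (Measure.pi fun _ : Fin m => P).real {X | sampleAvg f X < τ}
      ≤ P.real {ω | f ω < τ'} / (1 - τ / τ') := by
  have measurableSet_low : MeasurableSet {ω | f ω < τ'} := measurableSet_lt hf measurable_const
  set low : Ω → ℝ := Set.indicator {ω | f ω < τ'} 1 with low_def
  have low_integrable : Integrable low P := (integrable_const 1).indicator measurableSet_low
  have markov := real_le_sampleAvg_le low_integrable
    (fun ω => Set.indicator_nonneg (fun _ _ => zero_le_one) ω) hm
    (sub_pos.2 ((div_lt_one hτ').2 hττ'))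
  rw [low_def, integral_indicator_one measurableSet_low, ← low_def] at markov
  refine (measureReal_mono fun X hX => ?_).trans markov
  have pointwise (ω : Ω) : τ' * (1 - low ω) ≤ f ω := by
    by_cases hω : f ω < τ'
    · simpa [low, hω] using hf0 ω
    · simp [low, hω, not_lt.1 hω]
  have average : sampleAvg (fun ω => τ' * (1 - low ω)) X = τ' * (1 - sampleAvg low X) := by
    have : (m : ℝ) ≠ 0 := by positivity
    simp only [sampleAvg, ← Finset.mul_sum, Finset.sum_sub_distrib, Finset.sum_const,
      Finset.card_univ, Fintype.card_fin, nsmul_eq_mul]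
    field_simp
  have := (average ▸ sampleAvg_mono pointwise X).trans_lt hX
  rw [Set.mem_ofPred_eq, sub_le_comm, le_div_iff₀ hτ']
  linarith

theorem variance_sampleAvg {f : Ω → ℝ} (hf : MemLp f 2 P) :
    Var[sampleAvg f; Measure.pi fun _ : Fin m => P] = Var[f; P] / m := by
  have as_sum : (sampleAvg f : (Fin m → Ω) → ℝ)
      = fun X => (m : ℝ)⁻¹ * (∑ j : Fin m, fun X : Fin m → Ω => f (X j)) X := by
    funext X
    rw [sampleAvg, Finset.sum_apply, div_eq_inv_mul]
  rw [as_sum, variance_const_mul,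
    variance_sum_pi (μ := fun _ : Fin m => P) (X := fun _ => f) fun _ => hf]
  simp only [Finset.sum_const, Finset.card_univ, Fintype.card_fin, nsmul_eq_mul]
  rcases eq_or_ne (m : ℝ) 0 with h0 | h0
  · simp [h0]
  · field_simp

theorem real_abs_sampleAvg_sub_le {f : Ω → ℝ} (hf : MemLp f 2 P) (hm : 1 ≤ m) {ε : ℝ}
    (hε : 0 < ε) :
    (Measure.pi fun _ : Fin m => P).real {X | ε ≤ |sampleAvg f X - ∫ ω, f ω ∂P|}
      ≤ (∫ ω, f ω ^ 2 ∂P) / (m * ε ^ 2) := by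
  have memLp_sampleAvg : MemLp (sampleAvg f) 2 (Measure.pi fun _ : Fin m => P) := by
    rw [show (sampleAvg f : (Fin m → Ω) → ℝ) = fun X => (m : ℝ)⁻¹ * ∑ j, f (X j) from
      funext fun X => div_eq_inv_mul _ _]
    exact (memLp_finsetSum _ fun j _ => hf.comp_measurePreserving
      (measurePreserving_eval (fun _ : Fin m => P) j)).const_mul _
  have chebyshev := ENNReal.toReal_le_of_le_ofReal
    (div_nonneg (variance_nonneg _ _) (sq_nonneg ε))
    (meas_ge_le_variance_div_sq memLp_sampleAvg hε)
  rw [integral_sampleAvg (hf.integrable one_le_two) hm, variance_sampleAvg hf, div_div]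
    at chebyshev
  refine (show _ ≤ _ from chebyshev).trans ?_
  gcongr
  exact variance_le_expectation_sq hf.1

theorem real_le_sampleAvg_le_pow {f : Ω → ℝ} {t : ℝ}
    (hf : Integrable (fun ω => Real.exp (t * f ω)) P) (hm : 1 ≤ m) (ht : 0 ≤ t) (τ : ℝ) :
    (Measure.pi fun _ : Fin m => P).real {X | τ ≤ sampleAvg f X}
      ≤ (Real.exp (-t * τ) * ∫ ω, Real.exp (t * f ω) ∂P) ^ m := by
  have exp_sum (X : Fin m → Ω) : Real.exp (t * ∑ j, f (X j)) = ∏ j, Real.exp (t * f (X j)) := by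
    rw [Finset.mul_sum, Real.exp_sum]
  have exp_integrable : Integrable (fun X : Fin m → Ω => Real.exp (t * ∑ j, f (X j)))
      (Measure.pi fun _ : Fin m => P) := by
    simp_rw [exp_sum]
    exact Integrable.fintype_prod fun _ => hf
  have mgf_eq : mgf (fun X : Fin m → Ω => ∑ j, f (X j)) (Measure.pi fun _ : Fin m => P) t
      = (∫ ω, Real.exp (t * f ω) ∂P) ^ m := by
    simp_rw [mgf, exp_sum]
    rw [integral_fintype_prod_eq_pow (fun ω => Real.exp (t * f ω)), Fintype.card_fin]
  have as_sum : {X : Fin m → Ω | τ ≤ sampleAvg f X} = {X | m * τ ≤ ∑ j, f (X j)} := by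
    ext X
    rw [Set.mem_ofPred_eq, Set.mem_ofPred_eq, sampleAvg, le_div_iff₀' (by positivity)]
  rw [as_sum, mul_pow, ← mgf_eq, ← Real.exp_nat_mul, mul_left_comm]
  exact measure_ge_le_exp_mul_mgf (m * τ) ht exp_integrable

end SampleAvg

/-! ### Convergence of Lipschitz means -/

section Lipschitz

variable {Ω : Type*} [MeasurableSpace Ω] {P : Measure Ω} [IsProbabilityMeasure P]
  {f : ℝ → ℝ} {L : ℝ≥0} {X Y : Ω → ℝ}

theorem integrable_comp_of_lipschitzWith (hf : LipschitzWith L f) (hX : Integrable X P) :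
    Integrable (fun ω => f (X ω)) P := by
  refine ((integrable_const |f 0|).add (hX.abs.const_mul L)).mono'
    (hf.continuous.comp_aestronglyMeasurable hX.aestronglyMeasurable)
    (Eventually.of_forall fun ω => ?_)
  have := (abs_sub_abs_le_abs_sub (f (X ω)) (f 0)).trans (hf.dist_le_mul (X ω) 0)
  rw [Real.dist_eq, sub_zero] at this
  exact sub_le_iff_le_add'.1 this

theorem abs_integral_comp_sub_le_of_lipschitzWith (hf : LipschitzWith L f) (hX : Integrable X P)
    (hY : Integrable Y P) :
    |∫ ω, f (X ω) ∂P - ∫ ω, f (Y ω) ∂P| ≤ L * ∫ ω, |X ω - Y ω| ∂P := by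
  rw [← integral_sub (integrable_comp_of_lipschitzWith hf hX)
    (integrable_comp_of_lipschitzWith hf hY), ← integral_const_mul, ← Real.norm_eq_abs]
  exact norm_integral_le_of_norm_le ((hX.sub hY).abs.const_mul _)
    (Eventually.of_forall fun ω => hf.dist_le_mul (X ω) (Y ω))

/-- Truncation of a real number to the interval `[-R, R]`, where `R ≥ 0`. -/
def clip (R y : ℝ) : ℝ := max (-R) (min y R)

theorem lipschitzWith_clip (R : ℝ) : LipschitzWith 1 (clip R) :=
  (LipschitzWith.id.min_const R).const_max (-R)

theorem abs_clip_le {R : ℝ} (hR : 0 ≤ R) (y : ℝ) : |clip R y| ≤ R :=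
  abs_le.2 ⟨le_max_left _ _, max_le (by linarith) (min_le_right _ _)⟩

theorem abs_sub_clip_le {R : ℝ} (hR : 0 < R) (y : ℝ) : |y - clip R y| ≤ y ^ 2 / R := by
  rw [le_div_iff₀ hR]
  rcases le_total y R with h | h
  · rcases le_total (-R) y with h' | h'
    · simpa [clip, min_eq_left h, max_eq_right h'] using sq_nonneg y
    · rw [clip, min_eq_left h, max_eq_left h', abs_of_nonpos (by linarith)]
      nlinarith
  · rw [clip, min_eq_right h, max_eq_right (by linarith), abs_of_nonneg (by linarith)]
    nlinarith

theorem abs_integral_sub_integral_clip_le (hf : LipschitzWith L f) (hX : MemLp X 2 P) {R : ℝ}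
    (hR : 0 < R) :
    |∫ ω, f (X ω) ∂P - ∫ ω, f (clip R (X ω)) ∂P| ≤ L * ((∫ ω, X ω ^ 2 ∂P) / R) := by
  have integrable_X := hX.integrable one_le_two
  have integrable_clip : Integrable (fun ω => clip R (X ω)) P :=
    integrable_comp_of_lipschitzWith (lipschitzWith_clip R) integrable_X
  refine (abs_integral_comp_sub_le_of_lipschitzWith hf integrable_X integrable_clip).trans ?_
  rw [← integral_div]
  gcongr
  · exact (integrable_X.sub integrable_clip).abs
  · exact hX.integrable_sq.div_const R
  · exact fun ω => abs_sub_clip_le hR (X ω)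

theorem tendsto_integral_comp_of_tendstoInDistribution {ι : Type*} {Ω : ι → Type*}
    [∀ i, MeasurableSpace (Ω i)] {P : ∀ i, Measure (Ω i)} [∀ i, IsProbabilityMeasure (P i)]
    {Ω' : Type*} [MeasurableSpace Ω'] {Q : Measure Ω'} [IsProbabilityMeasure Q]
    {X : ∀ i, Ω i → ℝ} {Z : Ω' → ℝ} {l : Filter ι} (h : TendstoInDistribution X l Z P Q)
    (hX : ∀ i, MemLp (X i) 2 (P i)) {C : ℝ} (hXC : ∀ i, ∫ ω, X i ω ^ 2 ∂(P i) ≤ C)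
    (hZ : MemLp Z 2 Q) (hf : LipschitzWith L f) :
    Tendsto (fun i => ∫ ω, f (X i ω) ∂(P i)) l (𝓝 (∫ ω, f (Z ω) ∂Q)) := by
  have clipped (R : ℝ) (hR : 0 ≤ R) : Tendsto (fun i => ∫ ω, f (clip R (X i ω)) ∂(P i)) l
      (𝓝 (∫ ω, f (clip R (Z ω)) ∂Q)) := by
    have lipschitz := hf.comp (lipschitzWith_clip R)
    have bounded (y : ℝ) : ‖f (clip R y)‖ ≤ |f 0| + L * R := by
      have := (abs_sub_abs_le_abs_sub (f (clip R y)) (f 0)).trans (hf.dist_le_mul (clip R y) 0)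
      rw [Real.dist_eq, sub_zero] at this
      exact (sub_le_iff_le_add'.1 this).trans (by gcongr; exact abs_clip_le hR y)
    have := (ProbabilityMeasure.tendsto_iff_forall_integral_tendsto.1 h.tendsto)
      (.ofNormedAddCommGroup _ lipschitz.continuous _ bounded)
    have map_X (i : ι) : ∫ y, f (clip R y) ∂((P i).map (X i)) = ∫ ω, f (clip R (X i ω)) ∂(P i) :=
      integral_map (h.forall_aemeasurable i) lipschitz.continuous.aestronglyMeasurable
    have map_Z : ∫ y, f (clip R y) ∂(Q.map Z) = ∫ ω, f (clip R (Z ω)) ∂Q :=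
      integral_map h.aemeasurable_limit lipschitz.continuous.aestronglyMeasurable
    simpa [map_X, map_Z] using this
  set B : ℝ := max C (∫ ω, Z ω ^ 2 ∂Q)
  refine Metric.tendsto_nhds.2 fun ε hε => ?_
  obtain ⟨R, hR, hRε⟩ : ∃ R : ℝ, 0 < R ∧ L * (B / R) < ε / 3 := by
    have : Tendsto (fun R : ℝ => L * (B / R)) atTop (𝓝 (L * 0)) :=
      (tendsto_const_nhds.div_atTop tendsto_id).const_mul _
    rw [mul_zero] at this
    exact ((eventually_gt_atTop 0).and (this.eventually_lt_const (by positivity))).exists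
  filter_upwards [Metric.tendsto_nhds.1 (clipped R hR.le) (ε / 3) (by positivity)] with i hi
  have error_X := abs_integral_sub_integral_clip_le hf (hX i) hR
  have error_Z := abs_integral_sub_integral_clip_le hf hZ hR
  have moment_X : L * ((∫ ω, X i ω ^ 2 ∂(P i)) / R) ≤ L * (B / R) := by
    gcongr; exact (hXC i).trans (le_max_left _ _)
  have moment_Z : L * ((∫ ω, Z ω ^ 2 ∂Q) / R) ≤ L * (B / R) := by
    gcongr; exact le_max_right _ _
  rw [Real.dist_eq] at hi ⊢
  rw [abs_lt] at hi ⊢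
  rw [abs_le] at error_X error_Z
  constructor <;> linarith

end Lipschitz

theorem tendstoUniformlyOn_of_lipschitzWith {ι E : Type*} [PseudoMetricSpace E] {F : ι → E → ℝ}
    {f : E → ℝ} {l : Filter ι} {L : ℝ≥0} (hF : ∀ i, LipschitzWith L (F i)) {K : Set E}
    (hK : IsCompact K) (hlim : ∀ y ∈ K, Tendsto (fun i => F i y) l (𝓝 (f y))) :
    TendstoUniformlyOn F f l K := by
  have equicontinuous : EquicontinuousOn F K :=
    (LipschitzWith.uniformEquicontinuous F L hF).equicontinuous.equicontinuousOn K
  have := (EquicontinuousOn.tendsto_uniformOnFun_iff_pi' (𝔖 := {K}) (by simpa using hK)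
    (by simpa using equicontinuous) l f).2 (tendsto_pi_nhds.2 fun y => hlim y (by simpa using y.2))
  exact UniformOnFun.tendsto_iff_tendstoUniformlyOn.1 this K rfl

/-! ### The folded Gaussian mean -/

theorem memLp_id_gaussian : MemLp (fun z : ℝ => z) 2 (gaussianReal 0 1) :=
  memLp_id_gaussianReal 2

theorem integrable_id_gaussian : Integrable (fun z : ℝ => z) (gaussianReal 0 1) :=
  memLp_id_gaussian.integrable one_le_two

theorem integral_sq_gaussian : ∫ z, z ^ 2 ∂(gaussianReal 0 1) = 1 := by
  rw [← variance_of_integral_eq_zero (X := fun z => z) (by fun_prop) integral_id_gaussianReal,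
    variance_fun_id_gaussianReal, NNReal.coe_one]

theorem integral_comp_neg_gaussian {E : Type*} [NormedAddCommGroup E] [NormedSpace ℝ E]
    (f : ℝ → E) : ∫ z, f (-z) ∂(gaussianReal 0 1) = ∫ z, f z ∂(gaussianReal 0 1) := by
  have map_neg : (gaussianReal 0 1).map (MeasurableEquiv.neg ℝ) = gaussianReal 0 1 :=
    gaussianReal_map_neg.trans (by rw [neg_zero])
  conv_rhs => rw [← map_neg, integral_map_equiv]
  rfl

/-- The mean of `|y + s Z|` for a standard Gaussian variable `Z`, i.e. the mean of the folded
normal law with parameters `y` and `s ^ 2`. -/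
noncomputable def meanAbs (y s : ℝ) : ℝ := ∫ z, |y + s * z| ∂(gaussianReal 0 1)

section LocationScale

variable {Ω : Type*} [MeasurableSpace Ω] {P : Measure Ω} [IsProbabilityMeasure P] {X : Ω → ℝ}
  {f : ℝ → ℝ} {L : ℝ≥0}

theorem abs_integral_comp_add_mul_sub_le (hf : LipschitzWith L f) (hX : MemLp X 2 P)
    (hX1 : ∫ ω, X ω ^ 2 ∂P ≤ 1) (y y' s s' : ℝ) :
    |∫ ω, f (y + s * X ω) ∂P - ∫ ω, f (y' + s' * X ω) ∂P| ≤ L * (|y - y'| + |s - s'|) := by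
  have integrable_X := hX.integrable one_le_two
  have integrable_affine (y s : ℝ) : Integrable (fun ω => y + s * X ω) P :=
    (integrable_const y).add (integrable_X.const_mul s)
  have integral_abs_X : ∫ ω, |X ω| ∂P ≤ 1 :=
    (integral_abs_le_sqrt_integral_sq hX).trans (Real.sqrt_le_one.2 hX1)
  refine (abs_integral_comp_sub_le_of_lipschitzWith hf (integrable_affine y s)
    (integrable_affine y' s')).trans (mul_le_mul_of_nonneg_left ?_ L.2)
  calc ∫ ω, |y + s * X ω - (y' + s' * X ω)| ∂P
      ≤ ∫ ω, (|y - y'| + |s - s'| * |X ω|) ∂P := by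
        refine integral_mono ((integrable_affine y s).sub (integrable_affine y' s')).abs
          ((integrable_const _).add (integrable_X.abs.const_mul _)) fun ω => ?_
        rw [← abs_mul, show y + s * X ω - (y' + s' * X ω) = y - y' + (s - s') * X ω by ring]
        exact abs_add_le _ _
    _ = |y - y'| + |s - s'| * ∫ ω, |X ω| ∂P := by
        rw [integral_add (integrable_const _) (integrable_X.abs.const_mul _), integral_const_mul]
        simp
    _ ≤ |y - y'| + |s - s'| := by
        linarith [mul_le_of_le_one_right (abs_nonneg (s - s')) integral_abs_X]

theorem lipschitzWith_integral_comp_add_mul (hf : LipschitzWith L f) (hX : MemLp X 2 P)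
    (hX1 : ∫ ω, X ω ^ 2 ∂P ≤ 1) :
    LipschitzWith (L * 2) fun p : ℝ × ℝ => ∫ ω, f (p.1 + p.2 * X ω) ∂P := by
  refine LipschitzWith.of_dist_le_mul fun p q => ?_
  refine (abs_integral_comp_add_mul_sub_le hf hX hX1 p.1 q.1 p.2 q.2).trans ?_
  rw [NNReal.coe_mul, mul_assoc, NNReal.coe_ofNat, two_mul]
  gcongr
  · exact le_max_left (dist p.1 q.1) (dist p.2 q.2)
  · exact le_max_right (dist p.1 q.1) (dist p.2 q.2)

end LocationScale

theorem integral_inv_sqrt_mul_sum_spin_sq_le_one (n : ℕ) :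
    ∫ σ : Config n, ((√n)⁻¹ * ∑ i, spin (σ i)) ^ 2 ∂(uniformSpins n) ≤ 1 := by
  simp only [mul_pow, integral_const_mul, integral_sum_spin_sq, Finset.card_univ,
    Fintype.card_fin, inv_pow, Real.sq_sqrt (Nat.cast_nonneg n)]
  exact inv_mul_le_one

theorem tendstoUniformlyOn_integral_comp_add_mul_sum_spin {f : ℝ → ℝ} {L : ℝ≥0}
    (hf : LipschitzWith L f) {K : Set (ℝ × ℝ)} (hK : IsCompact K) :
    TendstoUniformlyOn
      (fun n p => ∫ σ, f (p.1 + p.2 * ((√n)⁻¹ * ∑ i, spin (σ i))) ∂(uniformSpins n))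
      (fun p => ∫ z, f (p.1 + p.2 * z) ∂(gaussianReal 0 1)) atTop K := by
  refine tendstoUniformlyOn_of_lipschitzWith (fun n => lipschitzWith_integral_comp_add_mul hf
    .of_discrete (integral_inv_sqrt_mul_sum_spin_sq_le_one n)) hK fun p _ => ?_
  have lipschitz_affine : LipschitzWith (L * ‖p.2‖₊) fun z => f (p.1 + p.2 * z) :=
    hf.comp (LipschitzWith.of_dist_le_mul fun z w => by
      rw [Real.dist_eq, Real.dist_eq, coe_nnnorm, Real.norm_eq_abs, ← abs_mul]
      exact (congrArg _ (by ring)).le)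
  exact tendsto_integral_comp_of_tendstoInDistribution (f := fun z => f (p.1 + p.2 * z))
    tendstoInDistribution_inv_sqrt_mul_sum_spin (fun _ => .of_discrete)
    integral_inv_sqrt_mul_sum_spin_sq_le_one (memLp_id_gaussianReal 2) lipschitz_affine

section MeanAbs

theorem integrable_abs_add_mul_gaussian (y s : ℝ) :
    Integrable (fun z : ℝ => |y + s * z|) (gaussianReal 0 1) :=
  ((integrable_const y).add (integrable_id_gaussian.const_mul s)).abs

theorem abs_meanAbs_sub_le (y y' s s' : ℝ) :
    |meanAbs y s - meanAbs y' s'| ≤ |y - y'| + |s - s'| := by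
  simpa [meanAbs] using abs_integral_comp_add_mul_sub_le (lipschitzWith_one_norm (E := ℝ))
    memLp_id_gaussian integral_sq_gaussian.le y y' s s'

theorem max_abs_abs_eq (a b : ℝ) : max |a| |b| = (|a + b| + |a - b|) / 2 := by
  rw [max_def]
  split_ifs with h
  · cases abs_cases a <;> cases abs_cases b <;> cases abs_cases (a + b) <;>
      cases abs_cases (a - b) <;> linarith
  · cases abs_cases a <;> cases abs_cases b <;> cases abs_cases (a + b) <;>
      cases abs_cases (a - b) <;> linarith

-- Average over `z` and `-z`. This form makes the dependence of the mean on `y` transparent.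
theorem meanAbs_eq_integral_max (y s : ℝ) :
    meanAbs y s = ∫ z, max |y| |s * z| ∂(gaussianReal 0 1) := by
  have reflected : meanAbs y s = ∫ z, |y - s * z| ∂(gaussianReal 0 1) := by
    rw [meanAbs, ← integral_comp_neg_gaussian]
    simp only [mul_neg, ← sub_eq_add_neg]
  have integrable_sub : Integrable (fun z => |y - s * z|) (gaussianReal 0 1) :=
    ((integrable_const y).sub (integrable_id_gaussian.const_mul s)).abs
  simp_rw [max_abs_abs_eq]
  rw [integral_div, integral_add (integrable_abs_add_mul_gaussian y s) integrable_sub, ← reflected,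
    ← meanAbs, add_self_div_two]

theorem integrable_max_gaussian (y s : ℝ) :
    Integrable (fun z : ℝ => max |y| |s * z|) (gaussianReal 0 1) :=
  (integrable_const |y|).sup (integrable_id_gaussian.const_mul s).abs

theorem meanAbs_mono {y y' : ℝ} (h : |y| ≤ |y'|) (s : ℝ) : meanAbs y s ≤ meanAbs y' s := by
  rw [meanAbs_eq_integral_max, meanAbs_eq_integral_max]
  exact integral_mono (integrable_max_gaussian y s) (integrable_max_gaussian y' s)
    fun z => max_le_max_right _ h

theorem exists_meanAbs_gap {x : ℝ} (hx : 0 < x) (s₀ : ℝ) :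
    ∃ γ > 0, ∀ s, 0 ≤ s → s ≤ s₀ → meanAbs 0 s + γ ≤ meanAbs x s := by
  let gap : ℝ → ℝ := fun z => max (x - s₀ * |z|) 0
  have gap_continuous : Continuous gap := by fun_prop
  have gap_integrable : Integrable gap (gaussianReal 0 1) :=
    ((integrable_const x).sub (integrable_id_gaussian.abs.const_mul s₀)).sup (integrable_const 0)
  refine ⟨∫ z, gap z ∂(gaussianReal 0 1), ?_, fun s h0 hs => ?_⟩
  · have support_nonempty : (Function.support gap).Nonempty := ⟨0, by simp [gap, hx]⟩
    have gap_nonneg : 0 ≤ gap := fun _ => le_max_right _ _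
    rw [gt_iff_lt, integral_pos_iff_support_of_nonneg gap_nonneg gap_integrable, pos_iff_ne_zero]
    exact fun h => (gap_continuous.isOpen_support.measure_pos volume support_nonempty).ne'
      (gaussianReal_absolutelyContinuous' 0 one_ne_zero h)
  · rw [meanAbs_eq_integral_max, meanAbs_eq_integral_max,
      ← integral_add (integrable_max_gaussian 0 s) gap_integrable]
    refine integral_mono ((integrable_max_gaussian 0 s).add gap_integrable)
      (integrable_max_gaussian x s) fun z => ?_
    have : s * |z| ≤ s₀ * |z| := by gcongr
    simp only [gap, abs_zero, abs_of_pos hx, abs_mul, abs_of_nonneg h0,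
      max_eq_right (mul_nonneg h0 (abs_nonneg z)), ← max_add_add_left, add_zero]
    exact max_le_max (by linarith) le_rfl

end MeanAbs

theorem hasDerivAt_gaussianPDF (z : ℝ) :
    HasDerivAt (gaussianPDFReal 0 1) (-(z * gaussianPDFReal 0 1 z)) z := by
  have exponent : HasDerivAt (fun z : ℝ => -(z - 0) ^ 2 / (2 * (1 : ℝ≥0))) (-z) z := by
    convert! ((hasDerivAt_id z).sub_const 0).pow 2 |>.neg.div_const (2 * ((1 : ℝ≥0) : ℝ)) using 1
    simp [neg_div]
  convert! exponent.exp.const_mul (√(2 * Real.pi * (1 : ℝ≥0)))⁻¹ using 1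
  rw [gaussianPDFReal]
  ring

theorem integrable_mul_gaussianPDF : Integrable fun z => z * gaussianPDFReal 0 1 z := by
  have h := integrable_id_gaussian
  rw [gaussianReal_of_var_ne_zero 0 one_ne_zero, integrable_withDensity_iff_integrable_smul'
    (measurable_gaussianPDF 0 1) (ae_of_all _ fun _ => gaussianPDF_lt_top)] at h
  simpa [mul_comm] using h

theorem setIntegral_Iic_gaussian (c : ℝ) :
    ∫ z in Set.Iic c, z ∂(gaussianReal 0 1) = -gaussianPDFReal 0 1 c := by
  have deriv_integrable : IntegrableOn (fun z => -(z * gaussianPDFReal 0 1 z)) (Set.Iic c) :=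
    integrable_mul_gaussianPDF.neg.integrableOn
  have tendsto_zero : Tendsto (gaussianPDFReal 0 1) atBot (𝓝 0) :=
    tendsto_zero_of_hasDerivAt_of_integrableOn_Iic (fun z _ => hasDerivAt_gaussianPDF z)
      deriv_integrable (integrable_gaussianPDFReal 0 1).integrableOn
  have antiderivative := integral_Iic_of_hasDerivAt_of_tendsto'
    (fun z _ => hasDerivAt_gaussianPDF z) deriv_integrable tendsto_zero
  rw [integral_neg, sub_zero] at antiderivative
  rw [← antiderivative, neg_neg, ← integral_indicator measurableSet_Iic,
    integral_gaussianReal_eq_integral_smul one_ne_zero, ← integral_indicator measurableSet_Iic]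
  congr 1
  funext z
  by_cases hz : z ≤ c <;> simp [hz, mul_comm]

theorem abs_eq_sub_two_mul_indicator {E : Type*} (g : E → ℝ) (e : E) :
    |g e| = g e - 2 * Set.indicator {e | g e ≤ 0} g e := by
  rcases le_or_gt (g e) 0 with h | h
  · rw [Set.indicator_of_mem (by exact h), abs_of_nonpos h]
    ring
  · rw [Set.indicator_of_notMem (by simpa using h), abs_of_pos h]
    ring

theorem meanAbs_eq_cdf (y : ℝ) {s : ℝ} (hs : 0 < s) :
    meanAbs y s = y * (1 - 2 * cdf (gaussianReal 0 1) (-y / s))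
      + 2 * s * gaussianPDFReal 0 1 (-y / s) := by
  have affine_integrable : Integrable (fun z : ℝ => y + s * z) (gaussianReal 0 1) :=
    (integrable_const y).add (integrable_id_gaussian.const_mul s)
  have negative_part : {z : ℝ | y + s * z ≤ 0} = Set.Iic (-y / s) := by
    ext z
    rw [Set.mem_ofPred_eq, Set.mem_Iic, le_div_iff₀ hs, mul_comm]
    constructor <;> intro h <;> linarith
  have mean_affine : ∫ z, (y + s * z) ∂(gaussianReal 0 1) = y := by
    rw [integral_add (integrable_const _) (integrable_id_gaussian.const_mul s),
      integral_const_mul, integral_id_gaussianReal]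
    simp
  have mean_negative_part : ∫ z in Set.Iic (-y / s), (y + s * z) ∂(gaussianReal 0 1)
      = y * cdf (gaussianReal 0 1) (-y / s) - s * gaussianPDFReal 0 1 (-y / s) := by
    rw [integral_add (integrable_const _) (integrable_id_gaussian.const_mul s).integrableOn,
      integral_const_mul, setIntegral_Iic_gaussian, setIntegral_const, cdf_eq_real, smul_eq_mul]
    ring
  simp_rw [meanAbs, abs_eq_sub_two_mul_indicator (fun z : ℝ => y + s * z), negative_part]
  rw [integral_sub affine_integrable ((affine_integrable.indicator measurableSet_Iic).const_mul 2),
    integral_const_mul, integral_indicator measurableSet_Iic, mean_affine, mean_negative_part]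
  ring

theorem foldedMean_eq_meanAbs (x : ℝ) {v : ℝ} (hv : 0 < v) : foldedMean x v = meanAbs x √v := by
  have density : gaussianPDFReal 0 1 (-x / √v)
      = (√(2 * Real.pi))⁻¹ * Real.exp (-(x ^ 2) / (2 * v)) := by
    rw [gaussianPDFReal, NNReal.coe_one, sub_zero, div_pow, neg_sq, Real.sq_sqrt hv.le]
    congr 2
    · rw [mul_one]
    · field_simp
  have normalization : √(2 / Real.pi) = 2 * (√(2 * Real.pi))⁻¹ := by
    rw [← Real.sqrt_inv, show (2 : ℝ) / Real.pi = 2 ^ 2 * (2 * Real.pi)⁻¹ by field_simp,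
      Real.sqrt_mul (by norm_num), Real.sqrt_sq (by norm_num)]
  rw [meanAbs_eq_cdf x (Real.sqrt_pos.2 hv), density, foldedMean, normalization]
  ring

/-! ### The global statistic -/

theorem globalTerm_eq_abs_add {n : ℕ} (S : Finset (Fin n)) (σ : Config n) :
    globalTerm S.card σ = |magnetization S σ + (∑ i ∈ Sᶜ, spin (σ i)) / S.card| := by
  rw [globalTerm, magnetization, ← Finset.sum_add_sum_compl S, add_div]

theorem globalStat_eq_sampleAvg {n m : ℕ} (k : ℕ) (X : Fin m → Config n) :
    globalStat k X = sampleAvg (globalTerm k) X :=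
  rfl

theorem integral_uniformSpins_abs_div_le {n : ℕ} (A : Finset (Fin n)) (k : ℕ) :
    ∫ σ, |(∑ i ∈ A, spin (σ i)) / k| ∂(uniformSpins n) ≤ √n / k := by
  simp_rw [abs_div, Nat.abs_cast]
  rw [integral_div]
  gcongr
  refine (integral_abs_sum_spin_le A).trans (Real.sqrt_le_sqrt ?_)
  exact_mod_cast A.card_le_univ.trans (by simp)

theorem nullSampleLaw_eq_pi_uniformSpins {μ : Measure ℝ} [IsProbabilityMeasure μ]
    (hsymm : μ.map (fun h => -h) = μ) (n m : ℕ) :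
    nullSampleLaw n m μ = Measure.pi fun _ => uniformSpins n := by
  rw [nullSampleLaw, nullLaw_eq_uniformSpins hsymm]

theorem sqrt_div_le {n k : ℕ} {A : ℝ} (hk : 0 < k) (hA : 0 < A) (h : A * √n ≤ k) :
    √n / k ≤ 1 / A := by
  rw [div_le_div_iff₀ (by positivity) hA]
  linarith

theorem exists_forall_sqrt_div_le (K : ℕ) {ε : ℝ} (hε : 0 < ε) :
    ∃ A : ℝ, ∀ n k : ℕ, 0 < k → k ≤ n → A * √n ≤ k → K ≤ k ∧ √n / k ≤ ε := by
  refine ⟨max √K (1 / ε), fun n k hk hkn h => ⟨?_, ?_⟩⟩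
  · have hsqrt : √k ≤ √n := Real.sqrt_le_sqrt (by exact_mod_cast hkn)
    have hprod : √K * √k ≤ √k * √k :=
      calc √K * √k ≤ max √K (1 / ε) * √n := by gcongr; exact le_max_left _ _
        _ ≤ √k * √k := by rwa [Real.mul_self_sqrt (Nat.cast_nonneg k)]
    have := le_of_mul_le_mul_right hprod (by positivity)
    exact_mod_cast (Real.sqrt_le_sqrt_iff (Nat.cast_nonneg k)).1 this
  · have : 1 / ε * √n ≤ k :=
      (mul_le_mul_of_nonneg_right (le_max_right _ _) (Real.sqrt_nonneg _)).trans h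
    simpa using sqrt_div_le hk (by positivity) this

section GlobalStatistic

variable {n : ℕ} {μ : Measure ℝ} [IsProbabilityMeasure μ]

theorem integral_cliqueLaw_comp_magnetization_compl (hsymm : μ.map (fun h => -h) = μ)
    {E : Type*} [NormedAddCommGroup E] [NormedSpace ℝ E] [CompleteSpace E] (θ : ℝ)
    (S : Finset (Fin n)) (g : ℝ → ℝ → E) :
    ∫ σ, g (magnetization S σ) (∑ i ∈ Sᶜ, spin (σ i)) ∂(cliqueLaw μ θ S)
      = ∫ σ, ∫ ε, g (magnetization S σ) (∑ i ∈ Sᶜ, spin (ε i)) ∂(uniformSpins n)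
          ∂(cliqueLaw μ θ S) := by
  have clique_part (σ ε : Config n) :
      magnetization S (S.piecewise σ ε) = magnetization S σ := by
    rw [magnetization, magnetization]
    exact congrArg (· / _) (Finset.sum_congr rfl fun i hi => by simp [hi])
  have outer_part (σ ε : Config n) :
      ∑ i ∈ Sᶜ, spin (S.piecewise σ ε i) = ∑ i ∈ Sᶜ, spin (ε i) :=
    Finset.sum_congr rfl fun i hi => by simp [Finset.mem_compl.1 hi]
  rw [integral_cliqueLaw_resample hsymm]
  simp_rw [clique_part, outer_part]

theorem cliqueLaw_abs_compl_le (hsymm : μ.map (fun h => -h) = μ) (θ : ℝ) (S : Finset (Fin n))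
    {c : ℝ} (hc : 0 < c) :
    (cliqueLaw μ θ S).real {σ | c ≤ |(∑ i ∈ Sᶜ, spin (σ i)) / S.card|} ≤ √n / S.card / c := by
  rw [le_div_iff₀ hc, mul_comm]
  refine (mul_meas_ge_le_integral_of_nonneg (.of_forall fun σ => abs_nonneg _) .of_finite c).trans
    ?_
  rw [integral_cliqueLaw_comp_magnetization_compl hsymm θ S fun _ w => |w / S.card|]
  simpa using integral_uniformSpins_abs_div_le Sᶜ S.card

theorem cliqueLaw_globalTerm_lt_le (hsymm : μ.map (fun h => -h) = μ) (θ : ℝ)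
    (S : Finset (Fin n)) (τ : ℝ) {c : ℝ} (hc : 0 < c) :
    (cliqueLaw μ θ S).real {σ | globalTerm S.card σ < τ}
      ≤ (cliqueLaw μ θ S).real {σ | |magnetization S σ| ≤ τ + c} + √n / S.card / c := by
  refine (measureReal_mono fun σ hσ => ?_).trans ((measureReal_union_le _ _).trans
    (add_le_add_right (cliqueLaw_abs_compl_le hsymm θ S hc) _))
  rw [Set.mem_ofPred_eq, globalTerm_eq_abs_add] at hσ
  have triangle := abs_sub_abs_le_abs_add (magnetization S σ) ((∑ i ∈ Sᶜ, spin (σ i)) / S.card)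
  by_contra! h
  simp only [Set.mem_union, Set.mem_ofPred_eq, not_or, not_le] at h
  linarith [h.1, h.2]

theorem cliqueLaw_abs_globalTerm_sub_ge_le (hsymm : μ.map (fun h => -h) = μ) (θ : ℝ)
    (S : Finset (Fin n)) (x ε : ℝ) {c : ℝ} (hc : 0 < c) :
    (cliqueLaw μ θ S).real {σ | ε + c ≤ |globalTerm S.card σ - x|}
      ≤ (cliqueLaw μ θ S).real {σ | ε ≤ |(|magnetization S σ| - x)|} + √n / S.card / c := by
  refine (measureReal_mono fun σ hσ => ?_).trans ((measureReal_union_le _ _).trans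
    (add_le_add_right (cliqueLaw_abs_compl_le hsymm θ S hc) _))
  rw [Set.mem_ofPred_eq, globalTerm_eq_abs_add] at hσ
  have perturbation := abs_abs_sub_abs_le_abs_sub
    (magnetization S σ + (∑ i ∈ Sᶜ, spin (σ i)) / S.card) (magnetization S σ)
  rw [add_sub_cancel_left] at perturbation
  have triangle := abs_sub_le |magnetization S σ + (∑ i ∈ Sᶜ, spin (σ i)) / S.card|
    |magnetization S σ| x
  by_contra! h
  simp only [Set.mem_union, Set.mem_ofPred_eq, not_or, not_le] at h
  linarith [h.1, h.2]

end GlobalStatistic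

/-! ### The global statistic for cliques much larger than `√n` -/

section LargeClique

variable {μ : Measure ℝ} [IsProbabilityMeasure μ] {θ x : ℝ}

theorem globalTerm_null_small (hsymm : μ.map (fun h => -h) = μ) {ε δ : ℝ} (hε : 0 < ε)
    (hδ : 0 < δ) :
    ∃ A : ℝ, ∀ n k : ℕ, 0 < k → A * √n ≤ k →
      (nullLaw n μ).real {σ | ε ≤ globalTerm k σ} ≤ δ := by
  refine ⟨1 / (ε * δ), fun n k hk h => ?_⟩
  have ratio_le := sqrt_div_le hk (by positivity) h
  rw [one_div_one_div] at ratio_le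
  rw [nullLaw_eq_uniformSpins hsymm]
  have markov := mul_meas_ge_le_integral_of_nonneg (μ := uniformSpins n) (f := globalTerm k)
    (.of_forall fun _ => abs_nonneg _) .of_finite ε
  have mean_le : ∫ σ, globalTerm k σ ∂(uniformSpins n) ≤ √n / k :=
    integral_uniformSpins_abs_div_le Finset.univ k
  exact le_of_mul_le_mul_left (by linarith) hε

theorem globalTerm_clique_small (hsymm : μ.map (fun h => -h) = μ) (hlow : 1 / meanSechSq μ < θ)
    (hx : IsLeast (positiveSolutions μ θ) x) (huniq : ∀ y ∈ positiveSolutions μ θ, y = x)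
    {ε δ : ℝ} (hε : 0 < ε) (hδ : 0 < δ) :
    ∃ A : ℝ, ∀ n k : ℕ, 0 < k → A * √n ≤ k → ∀ S : Finset (Fin n), S.card = k →
      (cliqueLaw μ θ S).real {σ | ε ≤ |globalTerm k σ - x|} ≤ δ := by
  obtain ⟨K, hK⟩ := cliqueLaw_abs_magnetization_sub_small hsymm hlow hx huniq (half_pos hε)
    (half_pos hδ)
  obtain ⟨A, hA⟩ := exists_forall_sqrt_div_le K (ε := δ / 2 * (ε / 2)) (by positivity)
  refine ⟨A, ?_⟩
  rintro n _ hk h S rfl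
  obtain ⟨hKS, hratio⟩ := hA n S.card hk (by simpa using S.card_le_univ) h
  rw [← add_halves ε, ← add_halves δ]
  exact (cliqueLaw_abs_globalTerm_sub_ge_le hsymm θ S x _ (half_pos hε)).trans
    (add_le_add (hK n S hKS) ((div_le_iff₀ (half_pos hε)).2 hratio))

theorem nullSampleLaw_globalStat_ge_le (hsymm : μ.map (fun h => -h) = μ) {n m : ℕ} (k : ℕ)
    (hm : 1 ≤ m) {τ : ℝ} (hτ : 0 < τ) :
    (nullSampleLaw n m μ).real {X | τ ≤ globalStat k X} ≤ √n / k / τ := by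
  simp only [nullSampleLaw_eq_pi_uniformSpins hsymm, globalStat_eq_sampleAvg]
  refine (real_le_sampleAvg_le .of_finite (fun _ => abs_nonneg _) hm hτ).trans ?_
  gcongr
  exact integral_uniformSpins_abs_div_le Finset.univ k

theorem globalTest_large_consistent (hsymm : μ.map (fun h => -h) = μ)
    (hlow : 1 / meanSechSq μ < θ) (hx : IsLeast (positiveSolutions μ θ) x) {τ δ : ℝ}
    (hτ : 0 < τ) (hτx : τ < x) (hδ : 0 < δ) :
    ∃ A : ℝ, ∀ n m k : ℕ, 0 < k → 1 ≤ m → A * √n ≤ k → ∀ S : Finset (Fin n), S.card = k →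
      totalError (m := m) μ θ (globalStat k) τ S ≤ δ := by
  obtain ⟨τ', hττ', hτ'x⟩ := exists_between hτx
  obtain ⟨ρ, hτ'ρ, hρx⟩ := exists_between hτ'x
  have hc : 0 < ρ - τ' := sub_pos.2 hτ'ρ
  have hτ' : 0 < τ' := hτ.trans hττ'
  have hfraction : 0 < 1 - τ / τ' := sub_pos.2 ((div_lt_one hτ').2 hττ')
  set η := δ / 4 * (1 - τ / τ')
  have hη : 0 < η := by positivity
  obtain ⟨K, hK⟩ := cliqueLaw_abs_magnetization_small hsymm hlow hx (hτ'.trans hτ'ρ).le hρx hη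
  obtain ⟨A, hA⟩ := exists_forall_sqrt_div_le K (ε := min (δ / 2 * τ) (η * (ρ - τ')))
    (by positivity)
  refine ⟨A, ?_⟩
  rintro n m _ hk hm h S rfl
  obtain ⟨hKS, hratio⟩ := hA n S.card hk (by simpa using S.card_le_univ) h
  obtain ⟨hratio_null, hratio_clique⟩ := le_min_iff.1 hratio
  have type_one : (nullSampleLaw n m μ).real {X | τ ≤ globalStat S.card X} ≤ δ / 2 :=
    (nullSampleLaw_globalStat_ge_le hsymm S.card hm hτ).trans ((div_le_iff₀ hτ).2 hratio_null)
  have one_sample : (cliqueLaw μ θ S).real {σ | globalTerm S.card σ < τ'} ≤ η + η := by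
    refine (cliqueLaw_globalTerm_lt_le hsymm θ S τ' hc).trans
      (add_le_add ?_ ((div_le_iff₀ hc).2 hratio_clique))
    simpa only [add_sub_cancel] using hK n S hKS
  have type_two : (cliqueSampleLaw m μ θ S).real {X | globalStat S.card X < τ} ≤ δ / 2 := by
    simp only [globalStat_eq_sampleAvg]
    refine (real_sampleAvg_lt_le .of_discrete (fun _ => abs_nonneg _) hm hτ' hττ').trans ?_
    exact (div_le_iff₀ hfraction).2 (one_sample.trans_eq (by ring))
  unfold totalError
  linarith

end LargeClique

/-! ### The global statistic for cliques of size at least of order `√n` -/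

section CriticalClique

variable {f : ℝ → ℝ} {L : ℝ≥0} {a : ℝ}

theorem eventually_le_mul_sqrt (ha : 0 < a) (C : ℝ) : ∀ᶠ n : ℕ in atTop, C ≤ a * √n :=
  ((Real.tendsto_sqrt_atTop.comp tendsto_natCast_atTop_atTop).const_mul_atTop
    ha).eventually_ge_atTop C

theorem lipschitzWith_comp_abs (hf : LipschitzWith L f) : LipschitzWith L fun z => f |z| := by
  simpa [Function.comp_def] using hf.comp (lipschitzWith_one_norm (E := ℝ))

theorem eventually_abs_integral_comp_add_div_sub_le (hf : LipschitzWith L f) (ha : 0 < a) {ε : ℝ}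
    (hε : 0 < ε) :
    ∀ᶠ n : ℕ in atTop, ∀ k : ℕ, a * √n ≤ k → ∀ y : ℝ, |y| ≤ 1 →
      |∫ σ, f (y + (∑ i, spin (σ i)) / k) ∂(uniformSpins n)
        - ∫ z, f (y + √n / k * z) ∂(gaussianReal 0 1)| ≤ ε := by
  have uniform := Metric.tendstoUniformlyOn_iff.1 (tendstoUniformlyOn_integral_comp_add_mul_sum_spin
    hf ((isCompact_Icc (a := (-1 : ℝ)) (b := 1)).prod (isCompact_Icc (a := 0) (b := 1 / a)))) ε hε
  filter_upwards [uniform, eventually_gt_atTop 0] with n hn hn0 k hk y hy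
  have sqrt_pos : 0 < √(n : ℝ) := Real.sqrt_pos.2 (by exact_mod_cast hn0)
  have hk0 : (0 : ℝ) < k := (mul_pos ha sqrt_pos).trans_le hk
  have hratio : √n / k ≤ 1 / a := sqrt_div_le (by exact_mod_cast hk0) ha hk
  have := hn (y, √n / k) ⟨abs_le.1 hy, by positivity, hratio⟩
  rw [dist_comm, Real.dist_eq] at this
  have rescale (w : ℝ) : √n / k * ((√n)⁻¹ * w) = w / k := by field_simp
  simp only [rescale] at this
  exact this.le

theorem abs_integral_comp_sum_compl_sub_le (hf : LipschitzWith L f) {n : ℕ} (S : Finset (Fin n))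
    (y : ℝ) :
    |∫ σ, f (y + (∑ i ∈ Sᶜ, spin (σ i)) / S.card) ∂(uniformSpins n)
      - ∫ σ, f (y + (∑ i, spin (σ i)) / S.card) ∂(uniformSpins n)| ≤ L * (1 / √S.card) := by
  refine (abs_integral_comp_sub_le_of_lipschitzWith hf .of_finite .of_finite).trans ?_
  gcongr
  have difference (σ : Config n) :
      |y + (∑ i ∈ Sᶜ, spin (σ i)) / S.card - (y + (∑ i, spin (σ i)) / S.card)|
        = |∑ i ∈ S, spin (σ i)| / S.card := by
    rw [← Finset.sum_add_sum_compl S, add_sub_add_left_eq_sub, ← sub_div, sub_add_cancel_right,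
      abs_div, abs_neg, Nat.abs_cast]
  simp_rw [difference]
  rw [integral_div, ← Real.sqrt_div_self']
  gcongr
  exact integral_abs_sum_spin_le S

variable {μ : Measure ℝ} [IsProbabilityMeasure μ]

-- Replacing the spins of the clique by fresh ones completes the sum over `Sᶜ` to a sum over all
-- sites at cost `O(1 / √|S|)`, so that the limit theorem for `n` uniform spins applies.
theorem eventually_abs_integral_cliqueLaw_sub_le (hsymm : μ.map (fun h => -h) = μ) (θ : ℝ)
    (hf : LipschitzWith L f) (ha : 0 < a) {ε : ℝ} (hε : 0 < ε) :
    ∀ᶠ n : ℕ in atTop, ∀ S : Finset (Fin n), a * √n ≤ S.card →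
      |∫ σ, f (globalTerm S.card σ) ∂(cliqueLaw μ θ S)
        - ∫ σ, ∫ z, f |magnetization S σ + √n / S.card * z| ∂(gaussianReal 0 1)
            ∂(cliqueLaw μ θ S)| ≤ ε := by
  have hf' := lipschitzWith_comp_abs hf
  filter_upwards [eventually_abs_integral_comp_add_div_sub_le hf' ha (half_pos hε),
    eventually_le_mul_sqrt ha ((2 * L / ε) ^ 2), eventually_le_mul_sqrt ha 1]
    with n clt card_large card_pos S hS
  have coupling_error : L * (1 / √S.card) ≤ ε / 2 := by
    have sqrt_pos : 0 < √(S.card : ℝ) := Real.sqrt_pos.2 (by linarith)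
    have := Real.le_sqrt_of_sq_le (card_large.trans hS)
    rw [div_le_iff₀ hε] at this
    rw [mul_one_div, div_le_iff₀ sqrt_pos]
    linarith
  simp_rw [globalTerm_eq_abs_add S]
  rw [integral_cliqueLaw_comp_magnetization_compl hsymm θ S fun y w => f |y + w / S.card|,
    ← integral_sub .of_finite .of_finite, ← Real.norm_eq_abs]
  refine (norm_integral_le_of_norm_le_const (C := ε) (.of_forall fun σ => ?_)).trans (by simp)
  rw [Real.norm_eq_abs, ← add_halves ε]
  exact (abs_sub_le _ _ _).trans (add_le_add
    ((abs_integral_comp_sum_compl_sub_le hf' S (magnetization S σ)).trans coupling_error)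
    (clt S.card hS _ (abs_magnetization_le_one S σ)))

theorem integral_uniformSpins_globalTerm_sq (n k : ℕ) :
    ∫ σ, globalTerm k σ ^ 2 ∂(uniformSpins n) = (√n / k) ^ 2 := by
  simp only [globalTerm, sq_abs, div_pow]
  rw [integral_div, integral_sum_spin_sq, Real.sq_sqrt (Nat.cast_nonneg n), Finset.card_univ,
    Fintype.card_fin]

theorem integral_cliqueLaw_globalTerm_sq_le (hsymm : μ.map (fun h => -h) = μ) (θ : ℝ) {n : ℕ}
    (S : Finset (Fin n)) :
    ∫ σ, globalTerm S.card σ ^ 2 ∂(cliqueLaw μ θ S) ≤ 2 + 2 * (√n / S.card) ^ 2 := by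
  have pointwise (σ : Config n) :
      globalTerm S.card σ ^ 2 ≤ 2 + 2 * ((∑ i ∈ Sᶜ, spin (σ i)) / S.card) ^ 2 := by
    rw [globalTerm_eq_abs_add, sq_abs]
    have := (sq_le_one_iff_abs_le_one _).2 (abs_magnetization_le_one S σ)
    linarith [add_sq_le (a := magnetization S σ) (b := (∑ i ∈ Sᶜ, spin (σ i)) / S.card)]
  have compl_sq : ∫ ε, ((∑ i ∈ Sᶜ, spin (ε i)) / S.card) ^ 2 ∂(uniformSpins n)
      ≤ (√n / S.card) ^ 2 := by
    simp only [div_pow]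
    rw [integral_div, integral_sum_spin_sq, Real.sq_sqrt (Nat.cast_nonneg n)]
    gcongr
    exact_mod_cast Sᶜ.card_le_univ.trans (by simp)
  calc ∫ σ, globalTerm S.card σ ^ 2 ∂(cliqueLaw μ θ S)
      ≤ ∫ σ, (2 + 2 * ((∑ i ∈ Sᶜ, spin (σ i)) / S.card) ^ 2) ∂(cliqueLaw μ θ S) :=
        integral_mono .of_finite .of_finite pointwise
    _ = 2 + 2 * ∫ ε, ((∑ i ∈ Sᶜ, spin (ε i)) / S.card) ^ 2 ∂(uniformSpins n) := by
        rw [integral_add .of_finite .of_finite, integral_const_mul,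
          integral_cliqueLaw_comp_magnetization_compl hsymm θ S fun _ w => (w / S.card) ^ 2]
        simp
    _ ≤ 2 + 2 * (√n / S.card) ^ 2 := by gcongr

theorem exists_forall_div_mul_sq_le (B : ℝ) {r δ : ℝ} (hr : 0 < r) (hδ : 0 < δ) :
    ∃ M : ℕ, ∀ m : ℕ, M ≤ m → 1 ≤ m ∧ B / (m * r ^ 2) ≤ δ := by
  have vanishes : Tendsto (fun m : ℕ => B / (m * r ^ 2)) atTop (𝓝 0) :=
    tendsto_const_nhds.div_atTop (tendsto_natCast_atTop_atTop.atTop_mul_const (by positivity))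
  exact eventually_atTop.1 ((eventually_ge_atTop 1).and (vanishes.eventually_le_const hδ))

theorem exists_nullSampleLaw_globalStat_ge_le (hsymm : μ.map (fun h => -h) = μ) (ha : 0 < a)
    {r δ : ℝ} (hr : 0 < r) (hδ : 0 < δ) :
    ∃ M : ℕ, ∀ᶠ n : ℕ in atTop, ∀ m k : ℕ, M ≤ m → a * √n ≤ k →
      (nullSampleLaw n m μ).real {X | meanAbs 0 (√n / k) + r ≤ globalStat k X} ≤ δ := by
  obtain ⟨M, hM⟩ := exists_forall_div_mul_sq_le ((1 / a) ^ 2) (half_pos hr) hδ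
  refine ⟨M, ?_⟩
  filter_upwards [eventually_abs_integral_comp_add_div_sub_le
    (lipschitzWith_comp_abs LipschitzWith.id) ha (half_pos hr), eventually_le_mul_sqrt ha 1]
    with n clt card_pos m k hm hk
  obtain ⟨hm1, hMm⟩ := hM m hm
  have hk0 : 0 < k := by exact_mod_cast (by linarith : (0 : ℝ) < k)
  have mean_close : |∫ σ, globalTerm k σ ∂(uniformSpins n) - meanAbs 0 (√n / k)| ≤ r / 2 := by
    simpa [globalTerm, meanAbs] using clt k hk 0 (by simp)
  have chebyshev := real_abs_sampleAvg_sub_le (P := uniformSpins n) (f := globalTerm k) .of_discrete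
    hm1 (half_pos hr)
  simp only [nullSampleLaw_eq_pi_uniformSpins hsymm, globalStat_eq_sampleAvg]
  refine (measureReal_mono fun X hX => ?_).trans (chebyshev.trans (le_trans ?_ hMm))
  · rw [Set.mem_ofPred_eq] at hX ⊢
    exact le_abs.2 (.inl (by linarith [(abs_le.1 mean_close).2]))
  · rw [integral_uniformSpins_globalTerm_sq]
    exact div_le_div_of_nonneg_right
      (pow_le_pow_left₀ (by positivity) (sqrt_div_le hk0 ha hk) 2) (by positivity)

variable {θ x : ℝ}

theorem le_integral_meanAbs_magnetization {n : ℕ} (S : Finset (Fin n)) {ρ : ℝ} (hρ : 0 ≤ ρ)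
    (hρx : ρ ≤ x) (s : ℝ) :
    meanAbs x s - (x - ρ) - x * (cliqueLaw μ θ S).real {σ | |magnetization S σ| ≤ ρ}
      ≤ ∫ σ, meanAbs (magnetization S σ) s ∂(cliqueLaw μ θ S) := by
  set low : Config n → ℝ := Set.indicator {σ | |magnetization S σ| ≤ ρ} 1 with low_def
  have lower_bound : ∫ σ, (meanAbs x s - (x - ρ) - x * low σ) ∂(cliqueLaw μ θ S)
      = meanAbs x s - (x - ρ)
        - x * (cliqueLaw μ θ S).real {σ | |magnetization S σ| ≤ ρ} := by
    rw [integral_sub .of_finite .of_finite, integral_const_mul, low_def,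
      integral_indicator_one (Set.toFinite _).measurableSet]
    simp
  rw [← lower_bound]
  refine integral_mono .of_finite .of_finite fun σ => ?_
  have lipschitz_bound (y : ℝ) := (le_abs_self _).trans (abs_meanAbs_sub_le x y s s)
  simp only [sub_self, abs_zero, add_zero] at lipschitz_bound
  by_cases hσ : |magnetization S σ| ≤ ρ
  · have low_eq : low σ = 1 := Set.indicator_of_mem (by exact hσ) _
    have := lipschitz_bound 0
    rw [sub_zero, abs_of_nonneg (hρ.trans hρx)] at this
    have := meanAbs_mono (by simp : |0| ≤ |magnetization S σ|) s
    simp only [low_eq]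
    linarith
  · have low_eq : low σ = 0 := Set.indicator_of_notMem (by exact hσ) _
    have := lipschitz_bound ρ
    rw [abs_of_nonneg (sub_nonneg.2 hρx)] at this
    have := meanAbs_mono ((abs_of_nonneg hρ).trans_le (not_le.1 hσ).le) s
    simp only [low_eq]
    linarith

theorem eventually_le_integral_cliqueLaw_globalTerm (hsymm : μ.map (fun h => -h) = μ)
    (hlow : 1 / meanSechSq μ < θ) (hx : IsLeast (positiveSolutions μ θ) x) (ha : 0 < a) {r : ℝ}
    (hr : 0 < r) :
    ∀ᶠ n : ℕ in atTop, ∀ S : Finset (Fin n), a * √n ≤ S.card →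
      meanAbs x (√n / S.card) - r ≤ ∫ σ, globalTerm S.card σ ∂(cliqueLaw μ θ S) := by
  have hx0 : 0 < x := hx.1.1
  obtain ⟨ρ, hρ, hρx⟩ := exists_between (max_lt (sub_lt_self x (by positivity : 0 < r / 4)) hx0)
  obtain ⟨hρr, hρ0⟩ := max_lt_iff.1 hρ
  obtain ⟨K, hK⟩ := cliqueLaw_abs_magnetization_small hsymm hlow hx hρ0.le hρx
    (by positivity : 0 < r / (4 * x))
  filter_upwards [eventually_abs_integral_cliqueLaw_sub_le hsymm θ LipschitzWith.id ha
    (by positivity : 0 < r / 4), eventually_le_mul_sqrt ha K] with n clt card_large S hS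
  have clique_close := (abs_le.1 (clt S hS)).1
  have magnetization_close := le_integral_meanAbs_magnetization (μ := μ) (θ := θ) S hρ0.le hρx.le
    (√n / S.card)
  have low_small := mul_le_mul_of_nonneg_left (hK n S (by exact_mod_cast card_large.trans hS))
    hx0.le
  have : x * (r / (4 * x)) = r / 4 := by field_simp
  simp only [id, meanAbs] at clique_close magnetization_close ⊢
  linarith

theorem exists_cliqueSampleLaw_globalStat_lt_le (hsymm : μ.map (fun h => -h) = μ)
    (hlow : 1 / meanSechSq μ < θ) (hx : IsLeast (positiveSolutions μ θ) x) (ha : 0 < a)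
    {r δ : ℝ} (hr : 0 < r) (hδ : 0 < δ) :
    ∃ M : ℕ, ∀ᶠ n : ℕ in atTop, ∀ m : ℕ, M ≤ m → ∀ S : Finset (Fin n), a * √n ≤ S.card →
      (cliqueSampleLaw m μ θ S).real
        {X | globalStat S.card X < meanAbs x (√n / S.card) - r} ≤ δ := by
  obtain ⟨M, hM⟩ := exists_forall_div_mul_sq_le (2 + 2 * (1 / a) ^ 2) (half_pos hr) hδ
  refine ⟨M, ?_⟩
  filter_upwards [eventually_le_integral_cliqueLaw_globalTerm hsymm hlow hx ha (half_pos hr),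
    eventually_le_mul_sqrt ha 1] with n mean_large card_pos m hm S hS
  obtain ⟨hm1, hMm⟩ := hM m hm
  have hS0 : 0 < S.card := by exact_mod_cast (by linarith : (0 : ℝ) < S.card)
  have chebyshev := real_abs_sampleAvg_sub_le (P := cliqueLaw μ θ S) (f := globalTerm S.card)
    .of_discrete hm1 (half_pos hr)
  simp only [cliqueSampleLaw, globalStat_eq_sampleAvg]
  refine (measureReal_mono fun X hX => ?_).trans (chebyshev.trans (le_trans ?_ hMm))
  · rw [Set.mem_ofPred_eq] at hX ⊢
    exact le_abs.2 (.inr (by linarith [mean_large S hS]))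
  · refine div_le_div_of_nonneg_right ((integral_cliqueLaw_globalTerm_sq_le hsymm θ S).trans ?_)
      (by positivity)
    have := pow_le_pow_left₀ (by positivity) (sqrt_div_le hS0 ha hS) 2
    linarith

theorem globalTest_critical_consistent (hsymm : μ.map (fun h => -h) = μ)
    (hlow : 1 / meanSechSq μ < θ) (hx : IsLeast (positiveSolutions μ θ) x) (ha : 0 < a)
    {t δ : ℝ} (ht0 : 0 < t) (ht1 : t < 1) (hδ : 0 < δ) :
    ∃ M N : ℕ, ∀ n m k : ℕ, N ≤ n → M ≤ m → a * √n ≤ k → ∀ S : Finset (Fin n), S.card = k →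
      totalError (m := m) μ θ (globalStat k)
        ((1 - t) * foldedMean 0 ((n : ℝ) / k ^ 2) + t * foldedMean x ((n : ℝ) / k ^ 2)) S ≤ δ := by
  obtain ⟨γ, hγ, hgap⟩ := exists_meanAbs_gap hx.1.1 (1 / a)
  have ht1' : 0 < 1 - t := sub_pos.2 ht1
  obtain ⟨M₀, h₀⟩ := exists_nullSampleLaw_globalStat_ge_le hsymm ha (mul_pos ht0 hγ) (half_pos hδ)
  obtain ⟨M₁, h₁⟩ := exists_cliqueSampleLaw_globalStat_lt_le hsymm hlow hx ha (mul_pos ht1' hγ)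
    (half_pos hδ)
  obtain ⟨N, hN⟩ := eventually_atTop.1 ((h₀.and h₁).and (eventually_le_mul_sqrt ha 1))
  refine ⟨max M₀ M₁, N, ?_⟩
  rintro n m _ hn hm hk S rfl
  obtain ⟨⟨type_one, type_two⟩, card_pos⟩ := hN n hn
  obtain ⟨hm₀, hm₁⟩ := max_le_iff.1 hm
  have hS0 : 0 < S.card := by exact_mod_cast (by linarith : (0 : ℝ) < S.card)
  have hn0 : 0 < n := hS0.trans_le (by simpa using S.card_le_univ)
  have hv : (0 : ℝ) < n / S.card ^ 2 := by positivity
  have sqrt_eq : √(n / S.card ^ 2 : ℝ) = √n / S.card := by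
    rw [Real.sqrt_div (Nat.cast_nonneg n), Real.sqrt_sq (Nat.cast_nonneg _)]
  have gap := hgap (√n / S.card) (by positivity) (sqrt_div_le hS0 ha hk)
  have gap_t := mul_le_mul_of_nonneg_left gap ht0.le
  have gap_t' := mul_le_mul_of_nonneg_left gap ht1'.le
  rw [foldedMean_eq_meanAbs 0 hv, foldedMean_eq_meanAbs x hv, sqrt_eq, ← add_halves δ]
  have : IsProbabilityMeasure (nullSampleLaw n m μ) := by unfold nullSampleLaw; infer_instance
  have : IsProbabilityMeasure (cliqueSampleLaw m μ θ S) := by unfold cliqueSampleLaw; infer_instance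
  refine add_le_add ((measureReal_mono fun X hX => ?_).trans (type_one m S.card hm₀ hk))
    ((measureReal_mono fun X hX => ?_).trans (type_two m hm₁ S hk))
  · rw [Set.mem_ofPred_eq] at hX ⊢
    linarith
  · rw [Set.mem_ofPred_eq] at hX ⊢
    linarith

end CriticalClique

/-! ### Folded normal limits -/

section FoldedNormalLimit

variable {f : ℝ → ℝ} {L : ℝ≥0} {x : ℝ} {v : ℝ≥0}

theorem tendstoInDistribution_of_forall_lipschitzWith {ι : Type*} {Ω : ι → Type*}
    [∀ i, MeasurableSpace (Ω i)] {P : ∀ i, Measure (Ω i)} [∀ i, IsProbabilityMeasure (P i)]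
    {Ω' : Type*} [MeasurableSpace Ω'] {Q : Measure Ω'} [IsProbabilityMeasure Q]
    {X : ∀ i, Ω i → ℝ} {Z : Ω' → ℝ} {l : Filter ι} [l.IsCountablyGenerated]
    (hX : ∀ i, AEMeasurable (X i) (P i)) (hZ : AEMeasurable Z Q)
    (h : ∀ (f : ℝ → ℝ) (L : ℝ≥0), LipschitzWith L f →
      Tendsto (fun i => ∫ ω, f (X i ω) ∂(P i)) l (𝓝 (∫ ω, f (Z ω) ∂Q))) :
    TendstoInDistribution X l Z P Q := by
  refine ⟨hX, hZ, tendsto_iff_forall_lipschitz_integral_tendsto.2 ?_⟩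
  rintro f - ⟨L, hf⟩
  simpa only [ProbabilityMeasure.coe_mk, integral_map (hX _) hf.continuous.aestronglyMeasurable,
    integral_map hZ hf.continuous.aestronglyMeasurable] using h f L hf

theorem integral_gaussianReal_eq {g : ℝ → ℝ} (hg : Measurable g) (x : ℝ) (v : ℝ≥0) :
    ∫ w, g w ∂(gaussianReal x v) = ∫ z, g (x + √v * z) ∂(gaussianReal 0 1) := by
  have map_affine : (gaussianReal 0 1).map (fun z => x + √(v : ℝ) * z) = gaussianReal x v := by
    have := Measure.map_map (μ := gaussianReal 0 1) (measurable_const_add x)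
      (measurable_const_mul √(v : ℝ))
    rw [gaussianReal_map_const_mul, gaussianReal_map_const_add, mul_zero, zero_add, mul_one] at this
    refine this.symm.trans ?_
    congr 1
    exact NNReal.eq (Real.sq_sqrt v.2)
  rw [← map_affine, integral_map (by fun_prop) hg.aestronglyMeasurable]

theorem foldedNormal_limits_of_forall_lipschitzWith {Ω : ℕ → Type*} [∀ j, MeasurableSpace (Ω j)]
    {P : ∀ j, Measure (Ω j)} [∀ j, IsProbabilityMeasure (P j)] {X : ∀ j, Ω j → ℝ}
    (hX : ∀ j, AEMeasurable (X j) (P j)) (hv : 0 < v)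
    (h : ∀ (f : ℝ → ℝ) (L : ℝ≥0), LipschitzWith L f →
      Tendsto (fun j => ∫ ω, f (X j ω) ∂(P j)) atTop
        (𝓝 (∫ z, f |x + √v * z| ∂(gaussianReal 0 1)))) :
    TendstoInDistribution X atTop (fun z : ℝ => |z|) P (gaussianReal x v) ∧
      Tendsto (fun j => ∫ ω, X j ω ∂(P j)) atTop (𝓝 (foldedMean x v)) := by
  refine ⟨tendstoInDistribution_of_forall_lipschitzWith hX (by fun_prop) fun f L hf => ?_, ?_⟩
  · rw [integral_gaussianReal_eq (lipschitzWith_comp_abs hf).continuous.measurable]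
    exact h f L hf
  · rw [foldedMean_eq_meanAbs x (by exact_mod_cast hv)]
    exact h id 1 LipschitzWith.id

theorem tendsto_of_forall_eventually_abs_sub_le {ι : Type*} {l : Filter ι} {u w : ι → ℝ} {c : ℝ}
    (hw : Tendsto w l (𝓝 c)) (h : ∀ ε > 0, ∀ᶠ i in l, |u i - w i| ≤ ε) : Tendsto u l (𝓝 c) := by
  have difference : Tendsto (fun i => u i - w i) l (𝓝 0) := by
    refine Metric.nhds_basis_closedBall.tendsto_right_iff.2 fun ε hε => ?_
    simpa only [Metric.mem_closedBall, dist_zero_right, Real.norm_eq_abs] using h ε hε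
  simpa using difference.add hw

end FoldedNormalLimit

section CriticalScaling

variable {n k : ℕ → ℕ} {v : ℝ}

theorem tendsto_sqrt_div (h : Tendsto (fun j => (n j : ℝ) / (k j : ℝ) ^ 2) atTop (𝓝 v)) :
    Tendsto (fun j => √(n j : ℝ) / k j) atTop (𝓝 √v) := by
  refine ((Real.continuous_sqrt.tendsto v).comp h).congr fun j => ?_
  rw [Function.comp_apply, Real.sqrt_div (Nat.cast_nonneg _), Real.sqrt_sq (Nat.cast_nonneg _)]

theorem exists_eventually_mul_sqrt_le (hv : 0 < v)
    (h : Tendsto (fun j => (n j : ℝ) / (k j : ℝ) ^ 2) atTop (𝓝 v)) :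
    ∃ a > 0, ∀ᶠ j in atTop, a * √(n j : ℝ) ≤ k j := by
  refine ⟨(√v + 1)⁻¹, by positivity, ?_⟩
  have ratio := tendsto_sqrt_div h
  filter_upwards [ratio.eventually_le_const (lt_add_one √v),
    ratio.eventually_const_lt (Real.sqrt_pos.2 hv)] with j hle hpos
  have hk : (k j : ℝ) ≠ 0 := fun h0 => by simp [h0] at hpos
  rw [div_le_iff₀ (by positivity)] at hle
  rwa [inv_mul_le_iff₀ (by positivity)]

end CriticalScaling

section GlobalTermLimits

variable {μ : Measure ℝ} [IsProbabilityMeasure μ] {θ x : ℝ} {f : ℝ → ℝ} {L : ℝ≥0}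

theorem globalTerm_null_limits (hsymm : μ.map (fun h => -h) = μ) (n k : ℕ → ℕ) (v : ℝ≥0)
    (hv : 0 < v) (hn : Tendsto n atTop atTop)
    (h : Tendsto (fun j => (n j : ℝ) / (k j : ℝ) ^ 2) atTop (𝓝 (v : ℝ))) :
    TendstoInDistribution (fun j => globalTerm (n := n j) (k j)) atTop (fun z : ℝ => |z|)
        (fun j => nullLaw (n j) μ) (gaussianReal 0 v) ∧
      Tendsto (fun j => ∫ σ, globalTerm (k j) σ ∂(nullLaw (n j) μ)) atTop
        (𝓝 (foldedMean 0 v)) := by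
  obtain ⟨a, ha, hak⟩ := exists_eventually_mul_sqrt_le (by exact_mod_cast hv) h
  refine foldedNormal_limits_of_forall_lipschitzWith (fun _ => Measurable.of_discrete.aemeasurable)
    hv fun f L hf => ?_
  have hf' := lipschitzWith_comp_abs hf
  have scale_limit := (((lipschitzWith_integral_comp_add_mul hf' memLp_id_gaussian
    integral_sq_gaussian.le).continuous.comp (Continuous.prodMk_right (0 : ℝ))).tendsto
      √(v : ℝ)).comp (tendsto_sqrt_div h)
  refine tendsto_of_forall_eventually_abs_sub_le scale_limit fun ε hε => ?_
  filter_upwards [hn.eventually (eventually_abs_integral_comp_add_div_sub_le hf' ha hε), hak]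
    with j clt hj
  simpa [nullLaw_eq_uniformSpins hsymm, globalTerm] using clt (k j) hj 0 (by simp)

theorem integral_abs_abs_magnetization_sub_le {n : ℕ} (S : Finset (Fin n)) (hx0 : 0 ≤ x)
    (hx1 : x ≤ 1) {ε : ℝ} (hε : 0 ≤ ε) :
    ∫ σ, |(|magnetization S σ| - x)| ∂(cliqueLaw μ θ S)
      ≤ ε + (cliqueLaw μ θ S).real {σ | ε ≤ |(|magnetization S σ| - x)|} := by
  set far : Config n → ℝ := Set.indicator {σ | ε ≤ |(|magnetization S σ| - x)|} 1 with far_def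
  have upper_bound : ∫ σ, (ε + far σ) ∂(cliqueLaw μ θ S)
      = ε + (cliqueLaw μ θ S).real {σ | ε ≤ |(|magnetization S σ| - x)|} := by
    rw [integral_add .of_finite .of_finite, far_def,
      integral_indicator_one (Set.toFinite _).measurableSet]
    simp
  rw [← upper_bound]
  refine integral_mono .of_finite .of_finite fun σ => ?_
  by_cases hσ : ε ≤ |(|magnetization S σ| - x)|
  · have far_eq : far σ = 1 := Set.indicator_of_mem (by exact hσ) _
    have := abs_magnetization_le_one S σ
    have := abs_nonneg (magnetization S σ)
    simp only [far_eq]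
    exact (abs_le.2 ⟨by linarith, by linarith⟩ : _ ≤ (1 : ℝ)).trans (by linarith)
  · have far_eq : far σ = 0 := Set.indicator_of_notMem (by exact hσ) _
    simp only [far_eq]
    linarith

theorem tendsto_integral_abs_abs_magnetization_sub (hsymm : μ.map (fun h => -h) = μ)
    (hlow : 1 / meanSechSq μ < θ) (hx : IsLeast (positiveSolutions μ θ) x)
    (huniq : ∀ y ∈ positiveSolutions μ θ, y = x) {n : ℕ → ℕ} (S : ∀ j, Finset (Fin (n j)))
    (hS : Tendsto (fun j => (S j).card) atTop atTop) :
    Tendsto (fun j => ∫ σ, |(|magnetization (S j) σ| - x)| ∂(cliqueLaw μ θ (S j))) atTop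
      (𝓝 0) := by
  refine tendsto_of_forall_eventually_abs_sub_le tendsto_const_nhds fun ε hε => ?_
  obtain ⟨K, hK⟩ := cliqueLaw_abs_magnetization_sub_small hsymm hlow hx huniq (half_pos hε)
    (half_pos hε)
  filter_upwards [hS.eventually_ge_atTop K] with j hj
  have := integral_abs_abs_magnetization_sub_le (μ := μ) (θ := θ) (S j) hx.1.1.le
    (positiveSolutions_le_one hx.1) (half_pos hε).le
  rw [sub_zero, abs_of_nonneg (integral_nonneg fun σ => abs_nonneg _)]
  linarith [hK _ (S j) hj]

theorem abs_integral_cliqueLaw_comp_abs_add_mul_sub_le (hf : LipschitzWith L f) {n : ℕ}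
    (S : Finset (Fin n)) (x s s' : ℝ) :
    |∫ σ, ∫ z, f |magnetization S σ + s * z| ∂(gaussianReal 0 1) ∂(cliqueLaw μ θ S)
      - ∫ z, f |x + s' * z| ∂(gaussianReal 0 1)|
      ≤ L * (∫ σ, |(|magnetization S σ| - x)| ∂(cliqueLaw μ θ S) + |s - s'|) := by
  have symmetrize (y : ℝ) : ∫ z, f |y + s * z| ∂(gaussianReal 0 1)
      = ∫ z, f |(|y| + s * z)| ∂(gaussianReal 0 1) := by
    rcases abs_choice y with hy | hy <;> rw [hy]
    rw [← integral_comp_neg_gaussian]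
    congr with z
    rw [← abs_neg]
    ring_nf
  have constant : ∫ z, f |x + s' * z| ∂(gaussianReal 0 1)
      = ∫ _, ∫ z, f |x + s' * z| ∂(gaussianReal 0 1) ∂(cliqueLaw μ θ S) := by simp
  have bound : L * (∫ σ, |(|magnetization S σ| - x)| ∂(cliqueLaw μ θ S) + |s - s'|)
      = ∫ σ, L * (|(|magnetization S σ| - x)| + |s - s'|) ∂(cliqueLaw μ θ S) := by
    rw [integral_const_mul, integral_add .of_finite .of_finite]
    simp
  simp only [symmetrize (magnetization S _)]
  rw [constant, bound, ← integral_sub .of_finite .of_finite]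
  exact abs_integral_le_integral_abs.trans (integral_mono .of_finite .of_finite fun σ =>
    abs_integral_comp_add_mul_sub_le (lipschitzWith_comp_abs hf) memLp_id_gaussian
      integral_sq_gaussian.le _ x s s')

theorem globalTerm_clique_limits (hsymm : μ.map (fun h => -h) = μ)
    (hlow : 1 / meanSechSq μ < θ) (hx : IsLeast (positiveSolutions μ θ) x)
    (huniq : ∀ y ∈ positiveSolutions μ θ, y = x) (n k : ℕ → ℕ) (S : ∀ j, Finset (Fin (n j)))
    (v : ℝ≥0) (hSk : ∀ j, (S j).card = k j) (hv : 0 < v) (hn : Tendsto n atTop atTop)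
    (h : Tendsto (fun j => (n j : ℝ) / (k j : ℝ) ^ 2) atTop (𝓝 (v : ℝ))) :
    TendstoInDistribution (fun j => globalTerm (n := n j) (k j)) atTop (fun z : ℝ => |z|)
        (fun j => cliqueLaw μ θ (S j)) (gaussianReal x v) ∧
      Tendsto (fun j => ∫ σ, globalTerm (k j) σ ∂(cliqueLaw μ θ (S j))) atTop
        (𝓝 (foldedMean x v)) := by
  obtain rfl : (fun j => (S j).card) = k := funext hSk
  obtain ⟨a, ha, hak⟩ := exists_eventually_mul_sqrt_le (by exact_mod_cast hv) h
  have card_tendsto : Tendsto (fun j => (S j).card) atTop atTop :=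
    tendsto_natCast_atTop_iff.1 (tendsto_atTop_mono' _ hak
      ((Real.tendsto_sqrt_atTop.comp (tendsto_natCast_atTop_atTop.comp hn)).const_mul_atTop ha))
  refine foldedNormal_limits_of_forall_lipschitzWith (fun _ => Measurable.of_discrete.aemeasurable)
    hv fun f L hf => ?_
  have magnetization_limit := tendsto_integral_abs_abs_magnetization_sub hsymm hlow hx huniq S
    card_tendsto
  have error_limit := (magnetization_limit.add
    ((tendsto_sqrt_div h).sub_const √(v : ℝ)).abs).const_mul (L : ℝ)
  simp only [sub_self, abs_zero, add_zero, mul_zero] at error_limit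
  have mixed_limit : Tendsto (fun j => ∫ σ, ∫ z, f |magnetization (S j) σ
      + √(n j : ℝ) / (S j).card * z| ∂(gaussianReal 0 1) ∂(cliqueLaw μ θ (S j))) atTop
      (𝓝 (∫ z, f |x + √v * z| ∂(gaussianReal 0 1))) :=
    tendsto_iff_norm_sub_tendsto_zero.2 (squeeze_zero (fun _ => norm_nonneg _)
      (fun j => abs_integral_cliqueLaw_comp_abs_add_mul_sub_le hf (S j) x _ √(v : ℝ)) error_limit)
  refine tendsto_of_forall_eventually_abs_sub_le mixed_limit fun ε hε => ?_
  filter_upwards [hn.eventually (eventually_abs_integral_cliqueLaw_sub_le hsymm θ hf ha hε), hak]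
    with j clt hj
  exact clt (S j) hj

end GlobalTermLimits

/-! ### The scan test -/

section ScanTest

theorem localStat_le_scanStat {n m : ℕ} (S : Finset (Fin n)) (X : Fin m → Config n) :
    localStat S X ≤ scanStat S.card X :=
  le_ciSup (f := fun T : {T : Finset (Fin n) // T.card = S.card} => localStat T.1 X)
    (Set.finite_range _).bddAbove ⟨S, rfl⟩

theorem setOf_le_scanStat_subset {n k : ℕ} (m : ℕ) (hkn : k ≤ n) (τ : ℝ) :
    {X : Fin m → Config n | τ ≤ scanStat k X}
      ⊆ ⋃ S ∈ Finset.powersetCard k Finset.univ, {X | τ ≤ localStat S X} := by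
  intro X hX
  obtain ⟨S₀, -, hS₀⟩ := Finset.exists_subset_card_eq (s := (Finset.univ : Finset (Fin n)))
    (by simpa using hkn)
  have : Nonempty {S : Finset (Fin n) // S.card = k} := ⟨⟨S₀, hS₀⟩⟩
  obtain ⟨S, hS⟩ := exists_eq_ciSup_of_finite
    (f := fun S : {S : Finset (Fin n) // S.card = k} => localStat S.1 X)
  exact Set.mem_biUnion (x := S.1) (by simp [S.2]) (hX.trans_eq hS.symm)

theorem choose_mul_pow_le_inv {n m k : ℕ} (hk : 0 < k) (hkn : k ≤ n) {τ : ℝ} (hτ : 0 < τ)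
    (hkτ : Real.log 2 ≤ k * τ ^ 2 / 4) (hmn : 8 / τ ^ 2 * Real.log n ≤ m) :
    n.choose k * (2 * Real.exp (-(k * τ ^ 2 / 2))) ^ m ≤ (1 / k : ℝ) := by
  have hn : (0 : ℝ) < n := by exact_mod_cast hk.trans_le hkn
  have choose_le : (n.choose k : ℝ) ≤ Real.exp (k * Real.log n) := by
    rw [Real.exp_nat_mul, Real.exp_log hn]
    exact_mod_cast Nat.choose_le_pow n k
  have factor_le : 2 * Real.exp (-(k * τ ^ 2 / 2)) ≤ Real.exp (-(k * τ ^ 2 / 4)) := by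
    rw [← Real.exp_log two_pos, ← Real.exp_add, Real.exp_log two_pos]
    exact Real.exp_le_exp.2 (by linarith)
  have exponent_le : k * (2 * Real.log n) ≤ m * (k * τ ^ 2 / 4) := by
    rw [div_mul_eq_mul_div, div_le_iff₀ (by positivity)] at hmn
    have := mul_le_mul_of_nonneg_left hmn (Nat.cast_nonneg k : (0 : ℝ) ≤ k)
    linarith
  have log_le : Real.log n ≤ k * Real.log n :=
    le_mul_of_one_le_left (Real.log_natCast_nonneg n) (by exact_mod_cast hk)
  calc n.choose k * (2 * Real.exp (-(k * τ ^ 2 / 2))) ^ m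
      ≤ Real.exp (k * Real.log n) * Real.exp (-(k * τ ^ 2 / 4)) ^ m := by gcongr
    _ = Real.exp (k * Real.log n - m * (k * τ ^ 2 / 4)) := by
        rw [← Real.exp_nat_mul, ← Real.exp_add]
        ring_nf
    _ ≤ Real.exp (-Real.log n) := Real.exp_le_exp.2 (by linarith)
    _ = 1 / n := by rw [Real.exp_neg, Real.exp_log hn, one_div]
    _ ≤ 1 / k := by gcongr

variable {μ : Measure ℝ} [IsProbabilityMeasure μ] {θ x : ℝ}

theorem nullSampleLaw_localStat_ge_le (hsymm : μ.map (fun h => -h) = μ) {n m : ℕ} (hm : 1 ≤ m)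
    {S : Finset (Fin n)} (hS : 0 < S.card) {τ : ℝ} (hτ : 0 ≤ τ) :
    (nullSampleLaw n m μ).real {X | τ ≤ localStat S X}
      ≤ (2 * Real.exp (-(S.card * τ ^ 2 / 2))) ^ m := by
  have chernoff := real_le_sampleAvg_le_pow (P := uniformSpins n) (t := S.card * τ)
    (f := fun σ => |magnetization S σ|) .of_finite hm (by positivity) τ
  have rescale (σ : Config n) : S.card * τ * |magnetization S σ| = τ * |∑ i ∈ S, spin (σ i)| := by
    rw [magnetization, abs_div, Nat.abs_cast]
    field_simp
  simp_rw [rescale] at chernoff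
  rw [nullSampleLaw_eq_pi_uniformSpins hsymm]
  refine (show _ ≤ _ from chernoff).trans (pow_le_pow_left₀ (by positivity) ?_ m)
  calc Real.exp (-(S.card * τ) * τ) * ∫ σ, Real.exp (τ * |∑ i ∈ S, spin (σ i)|) ∂(uniformSpins n)
      ≤ Real.exp (-(S.card * τ) * τ) * (2 * Real.exp (S.card * τ ^ 2 / 2)) := by
        gcongr
        exact integral_exp_abs_sum_spin_le S τ
    _ = 2 * Real.exp (-(S.card * τ ^ 2 / 2)) := by
        rw [mul_left_comm, ← Real.exp_add]
        ring_nf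

theorem nullSampleLaw_scanStat_ge_le (hsymm : μ.map (fun h => -h) = μ) {n m k : ℕ} (hm : 1 ≤ m)
    (hk : 0 < k) (hkn : k ≤ n) {τ : ℝ} (hτ : 0 ≤ τ) :
    (nullSampleLaw n m μ).real {X | τ ≤ scanStat k X}
      ≤ n.choose k * (2 * Real.exp (-(k * τ ^ 2 / 2))) ^ m := by
  have : IsProbabilityMeasure (nullSampleLaw n m μ) := by unfold nullSampleLaw; infer_instance
  refine (measureReal_mono (setOf_le_scanStat_subset m hkn τ) (measure_ne_top _ _)).trans
    ((measureReal_biUnion_finset_le _ _).trans ?_)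
  refine (Finset.sum_le_card_nsmul _ _ ((2 * Real.exp (-(k * τ ^ 2 / 2))) ^ m)
    fun S hS => ?_).trans_eq (by simp)
  obtain rfl := (Finset.mem_powersetCard.1 hS).2
  exact nullSampleLaw_localStat_ge_le hsymm hm hk hτ

theorem scanTest_consistent (hsymm : μ.map (fun h => -h) = μ)
    (hlow : 1 / meanSechSq μ < θ) (hx : IsLeast (positiveSolutions μ θ) x) {τ : ℝ} (hτ : 0 < τ)
    (hτx : τ < x) :
    ∃ C > 0, ∀ δ > 0, ∃ K : ℕ, ∀ n m k : ℕ, K ≤ k → C * Real.log n ≤ m →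
      ∀ S : Finset (Fin n), S.card = k → totalError (m := m) μ θ (scanStat k) τ S ≤ δ := by
  refine ⟨8 / τ ^ 2, by positivity, fun δ hδ => ?_⟩
  obtain ⟨τ', hττ', hτ'x⟩ := exists_between hτx
  have hτ' : 0 < τ' := hτ.trans hττ'
  have hfraction : 0 < 1 - τ / τ' := sub_pos.2 ((div_lt_one hτ').2 hττ')
  obtain ⟨K₁, hK₁⟩ := cliqueLaw_abs_magnetization_small hsymm hlow hx hτ'.le hτ'x
    (by positivity : 0 < δ / 2 * (1 - τ / τ'))
  obtain ⟨K₂, hK₂⟩ := exists_nat_ge (max (Real.log 2 / (τ ^ 2 / 4)) (max (2 / δ) 2))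
  refine ⟨max K₁ K₂, ?_⟩
  rintro n m _ hK hm S rfl
  have large_card := hK₂.trans (Nat.cast_le.2 (max_le_iff.1 hK).2)
  simp only [max_le_iff, div_le_iff₀ (by positivity : 0 < τ ^ 2 / 4)] at large_card
  obtain ⟨hSτ, hSδ, hS2⟩ := large_card
  have hS2 : 2 ≤ S.card := by exact_mod_cast hS2
  have hSn : S.card ≤ n := by simpa using S.card_le_univ
  have hm1 : 1 ≤ m := by
    have : 0 < Real.log n := Real.log_pos (by exact_mod_cast (by omega : 1 < n))
    exact_mod_cast (by positivity : 0 < 8 / τ ^ 2 * Real.log n).trans_le hm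
  have type_one : (nullSampleLaw n m μ).real {X | τ ≤ scanStat S.card X} ≤ δ / 2 := by
    refine (nullSampleLaw_scanStat_ge_le hsymm hm1 (by omega) hSn hτ.le).trans
      ((choose_mul_pow_le_inv (by omega) hSn hτ (by linarith) hm).trans ?_)
    rw [← inv_div 2 δ, ← one_div]
    exact one_div_le_one_div_of_le (by positivity) hSδ
  have type_two : (cliqueSampleLaw m μ θ S).real {X | scanStat S.card X < τ} ≤ δ / 2 := by
    have : IsProbabilityMeasure (cliqueSampleLaw m μ θ S) := by
      unfold cliqueSampleLaw; infer_instance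
    refine (measureReal_mono fun X hX => (localStat_le_scanStat S X).trans_lt hX).trans
      ((real_sampleAvg_lt_le (f := fun σ => |magnetization S σ|) .of_discrete
        (fun _ => abs_nonneg _) hm1 hτ' hττ').trans ((div_le_iff₀ hfraction).2 ?_))
    exact (measureReal_mono (Set.ofPred_subset_ofPred.2 fun _ => le_of_lt)).trans
      (hK₁ n S (max_le_iff.1 hK).1)
  unfold totalError
  linarith

end ScanTest

end PlantedRFCW

theorem mainTheorem7_general (μ : Measure ℝ) [IsProbabilityMeasure μ]
    (hsymm : μ.map (fun h => -h) = μ) (θ : ℝ) (hlow : 1 / meanSechSq μ < θ) :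
    ∃ x : ℝ, IsLeast (positiveSolutions μ θ) x ∧
      (∀ τ ∈ Set.Ioo 0 x, ∃ C > 0, ∀ δ > 0, ∃ K : ℕ, ∀ n m k : ℕ, K ≤ k →
        C * Real.log n ≤ m → ∀ S : Finset (Fin n), S.card = k →
          totalError (m := m) μ θ (scanStat k) τ S ≤ δ) ∧
      (∀ a : ℝ, 0 < a → ∀ t ∈ Set.Ioo (0 : ℝ) 1, ∀ δ > 0, ∃ M N : ℕ,
        ∀ n m k : ℕ, N ≤ n → M ≤ m → a * √n ≤ k →
          ∀ S : Finset (Fin n), S.card = k →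
            totalError (m := m) μ θ (globalStat k)
              ((1 - t) * foldedMean 0 ((n : ℝ) / k ^ 2) + t * foldedMean x ((n : ℝ) / k ^ 2)) S
                ≤ δ) ∧
      (∀ (n k : ℕ → ℕ) (v : ℝ≥0), 0 < v → Tendsto n atTop atTop →
        Tendsto (fun j => (n j : ℝ) / (k j : ℝ) ^ 2) atTop (𝓝 (v : ℝ)) →
          TendstoInDistribution (fun j => globalTerm (n := n j) (k j)) atTop (fun z : ℝ => |z|)
            (fun j => nullLaw (n j) μ) (gaussianReal 0 v) ∧
          Tendsto (fun j => ∫ σ, globalTerm (k j) σ ∂(nullLaw (n j) μ)) atTop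
            (𝓝 (foldedMean 0 v))) ∧
      ((∀ y ∈ positiveSolutions μ θ, y = x) →
        ∀ (n k : ℕ → ℕ) (S : ∀ j, Finset (Fin (n j))) (v : ℝ≥0), (∀ j, (S j).card = k j) → 0 < v →
          Tendsto n atTop atTop →
          Tendsto (fun j => (n j : ℝ) / (k j : ℝ) ^ 2) atTop (𝓝 (v : ℝ)) →
            TendstoInDistribution (fun j => globalTerm (n := n j) (k j)) atTop (fun z : ℝ => |z|)
              (fun j => cliqueLaw μ θ (S j)) (gaussianReal x v) ∧
            Tendsto (fun j => ∫ σ, globalTerm (k j) σ ∂(cliqueLaw μ θ (S j))) atTop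
              (𝓝 (foldedMean x v))) ∧
      (∀ τ ∈ Set.Ioo 0 x, ∀ δ > 0, ∃ A : ℝ, ∀ n m k : ℕ, 0 < k → 1 ≤ m → A * √n ≤ k →
        ∀ S : Finset (Fin n), S.card = k →
          totalError (m := m) μ θ (globalStat k) τ S ≤ δ) ∧
      (∀ ε > 0, ∀ δ > 0, ∃ A : ℝ, ∀ n k : ℕ, 0 < k → A * √n ≤ k →
        (nullLaw n μ).real {σ | ε ≤ globalTerm k σ} ≤ δ) ∧
      ((∀ y ∈ positiveSolutions μ θ, y = x) →
        ∀ ε > 0, ∀ δ > 0, ∃ A : ℝ, ∀ n k : ℕ, 0 < k → A * √n ≤ k →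
          ∀ S : Finset (Fin n), S.card = k →
            (cliqueLaw μ θ S).real {σ | ε ≤ |globalTerm k σ - x|} ≤ δ) := by
  obtain ⟨x, hx⟩ := exists_isLeast_positiveSolutions hsymm hlow
  exact ⟨x, hx, fun τ hτ => scanTest_consistent hsymm hlow hx hτ.1 hτ.2,
    fun a ha t ht δ hδ => globalTest_critical_consistent hsymm hlow hx ha ht.1 ht.2 hδ,
    globalTerm_null_limits hsymm, globalTerm_clique_limits hsymm hlow hx,
    fun τ hτ δ hδ => globalTest_large_consistent hsymm hlow hx hτ.1 hτ.2 hδ,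
    fun ε hε δ hδ => globalTerm_null_small hsymm hε hδ,
    fun huniq ε hε δ hδ => globalTerm_clique_small hsymm hlow hx huniq hε hδ⟩

theorem mainTheorem7 (μ : Measure ℝ) [IsProbabilityMeasure μ]
    (hsymm : μ.map (fun h => -h) = μ) (θ : ℝ) (hlow : 1 / meanSechSq μ < θ) :
    ∃ x : ℝ, IsLeast (positiveSolutions μ θ) x ∧
      -- scan test: `m ≥ C log n` samples suffice, uniformly over all sizes `k → ∞`
      (∀ τ ∈ Set.Ioo 0 x, ∃ C > 0, ∀ δ > 0, ∃ K : ℕ, ∀ n m k : ℕ, K ≤ k →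
        C * Real.log n ≤ m → ∀ S : Finset (Fin n), S.card = k →
          totalError (m := m) μ θ (scanStat k) τ S ≤ δ) ∧
      -- global test, `k ≍ √n`: a bounded number of samples suffices
      (∀ a b : ℝ, 0 < a → a ≤ b → ∀ t ∈ Set.Ioo (0 : ℝ) 1, ∀ δ > 0, ∃ M N : ℕ,
        ∀ n m k : ℕ, N ≤ n → M ≤ m → a * √n ≤ k → k ≤ b * √n →
          ∀ S : Finset (Fin n), S.card = k →
            totalError (m := m) μ θ (globalStat k)
              ((1 - t) * foldedMean 0 ((n : ℝ) / k ^ 2) + t * foldedMean x ((n : ℝ) / k ^ 2)) S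
                ≤ δ) ∧
      -- folded normal limit and convergence of means under the null, `n / k² → v`
      (∀ (n k : ℕ → ℕ) (v : ℝ≥0), 0 < v → Tendsto n atTop atTop →
        Tendsto (fun j => (n j : ℝ) / (k j : ℝ) ^ 2) atTop (𝓝 (v : ℝ)) →
          TendstoInDistribution (fun j => globalTerm (n := n j) (k j)) atTop (fun z : ℝ => |z|)
            (fun j => nullLaw (n j) μ) (gaussianReal 0 v) ∧
          Tendsto (fun j => ∫ σ, globalTerm (k j) σ ∂(nullLaw (n j) μ)) atTop
            (𝓝 (foldedMean 0 v))) ∧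
      -- folded normal limit and convergence of means under the alternative, `n / k² → v`
      ((∀ y ∈ positiveSolutions μ θ, y = x) →
        ∀ (n k : ℕ → ℕ) (S : ∀ j, Finset (Fin (n j))) (v : ℝ≥0), (∀ j, (S j).card = k j) → 0 < v →
          Tendsto n atTop atTop →
          Tendsto (fun j => (n j : ℝ) / (k j : ℝ) ^ 2) atTop (𝓝 (v : ℝ)) →
            TendstoInDistribution (fun j => globalTerm (n := n j) (k j)) atTop (fun z : ℝ => |z|)
              (fun j => cliqueLaw μ θ (S j)) (gaussianReal x v) ∧
            Tendsto (fun j => ∫ σ, globalTerm (k j) σ ∂(cliqueLaw μ θ (S j))) atTop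
              (𝓝 (foldedMean x v))) ∧
      -- global test, `k = ω(√n)`: one sample (or any larger number) suffices
      (∀ τ ∈ Set.Ioo 0 x, ∀ δ > 0, ∃ A : ℝ, ∀ n m k : ℕ, 0 < k → 1 ≤ m → A * √n ≤ k →
        ∀ S : Finset (Fin n), S.card = k →
          totalError (m := m) μ θ (globalStat k) τ S ≤ δ) ∧
      -- limits in probability of the one-sample statistic, `k = ω(√n)`
      (∀ ε > 0, ∀ δ > 0, ∃ A : ℝ, ∀ n k : ℕ, 0 < k → A * √n ≤ k →
        (nullLaw n μ).real {σ | ε ≤ globalTerm k σ} ≤ δ) ∧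
      ((∀ y ∈ positiveSolutions μ θ, y = x) →
        ∀ ε > 0, ∀ δ > 0, ∃ A : ℝ, ∀ n k : ℕ, 0 < k → A * √n ≤ k →
          ∀ S : Finset (Fin n), S.card = k →
            (cliqueLaw μ θ S).real {σ | ε ≤ |globalTerm k σ - x|} ≤ δ) := by
  obtain ⟨x, hx, scan, critical, rest⟩ := mainTheorem7_general μ hsymm θ hlow
  refine ⟨x, hx, scan, fun a b ha _ t ht δ hδ => ?_, rest⟩
  obtain ⟨M, N, h⟩ := critical a ha t ht δ hδ
  exact ⟨M, N, fun n m k hn hm hk _ => h n m k hn hm hk⟩
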